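/- For integers $p \ge 1$, $n \ge 2$ and a (known) symmetric positive definite matrix $\Sigma \in \mathbb{R}^{p\times p}$, let $X = (X_1,\dots,X_n)$ have independent columns $X_t \sim N_p(\theta_t,\Sigma)$, with law $\mathbb{P}_\theta$ and expectation $\mathbb{E}_\theta$. Let $\Theta_0(p,n)$ be the set of $\theta\in\mathbb{R}^{p\times n}$ with all columns equal. For $\rho>0$ and $s\in\{1,\dots,p\}$ let $\Theta(p,n,s,\rho)$ be the set of $\theta\in\mathbb{R}^{p\times n}$ for which there are $t_0\in\{1,\dots,n-1\}$ and $\mu_1,\mu_2\in\mathbb{R}^p$ with $\theta_t=\mu_1$ for $t\le t_0$, $\theta_t=\mu_2$ for $t>t_0$, at most $s$ nonzero coordinates in $\mu_1-\mu_2$, and $\frac{t_0(n-t_0)}{n}\|\mu_1-\mu_2\|^2\ge\rho^2$. In the case $s=p$ put $$\mathcal{R}_{p,n,\Sigma}(\rho)=\inf_{\psi}\Big\{\sup_{\theta\in\Theta_0(p,n)}\mathbb{E}_\theta\psi(X)+\sup_{\theta\in\Theta(p,n,p,\rho)}\mathbb{E}_\theta\big(1-\psi(X)\big)\Big\},$$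 the infimum being over all measurable $\psi:\mathbb{R}^{p\times n}\to[0,1]$. A positive function $\rho^*=\rho^*_\Sigma(p,n,p)$ of $(p,n,\Sigma)$ is called the minimax rate of testing if for every $\epsilon\in(0,1)$ there are $C_\epsilon,c_\epsilon>0$, depending only on $\epsilon$ (not on $p,n,\Sigma$), such that $\mathcal{R}_{p,n,\Sigma}(C\rho^*)\le\epsilon$ for all $C>C_\epsilon$ and $\mathcal{R}_{p,n,\Sigma}(c\rho^*)\ge1-\epsilon$ for all $c\in(0,c_\epsilon)$. **Theorem.** In the case $s=p$, the minimax rate of testing is given by $$\rho_\Sigma^*(p,n,p)^2\asymp\|\Sigma\|_F\sqrt{\log\log(8n)}\ \vee\ \|\Sigma\|_{\mathrm{op}}\log\log(8n),$$ where $\|\cdot\|_F$ and $\|\cdot\|_{\mathrm{op}}$ are the Frobenius and operator norms, $\vee$ is the maximum, and $\asymp$ means two-sided bounds with positive universal constants, not depending on $p$, $n$ or $\Sigma$. That is, the square root of the right-hand side is a minimax rate of testing, and a positive function $\rho^*$ of $(p,n,\Sigma)$ is a minimax rate of testing if and only if its square is bounded above and below by positive universal multiples of the right-hand side. -/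

import Mathlib

open MeasureTheory ProbabilityTheory

noncomputable section

namespace Changepoint

/-- A real `p × n` matrix, written as the sequence of its `n` columns in `ℝ^p`.
The column at time `t ∈ {1, …, n}` is the entry with index `t - 1 : Fin n`. -/
abbrev Obs (p n : ℕ) : Type := Fin n → EuclideanSpace ℝ (Fin p)

/-- The signals without a changepoint: all columns are equal. -/
def nullSpace (p n : ℕ) : Set (Obs p n) :=
  {θ | ∃ μ : EuclideanSpace ℝ (Fin p), ∀ t, θ t = μ}

/-- The signals with a change at time `t₀` in at most `s` coordinates, of strength at least `ρ`.
Times `1, …, t₀` are the indices `i` with `i < t₀`. -/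
def changeSpaceAt (p n s : ℕ) (ρ : ℝ) (t₀ : ℕ) : Set (Obs p n) :=
  {θ | ∃ μ₁ μ₂ : EuclideanSpace ℝ (Fin p),
    (∀ i : Fin n, (i : ℕ) < t₀ → θ i = μ₁) ∧
    (∀ i : Fin n, t₀ ≤ (i : ℕ) → θ i = μ₂) ∧
    hammingNorm (fun j => (μ₁ - μ₂) j) ≤ s ∧
    ρ ^ 2 ≤ ((t₀ : ℝ) * ((n : ℝ) - (t₀ : ℝ)) / (n : ℝ)) * ‖μ₁ - μ₂‖ ^ 2}

/-- The alternative: the union over all changepoint locations `t₀ ∈ {1, …, n - 1}`. -/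
def changeSpace (p n s : ℕ) (ρ : ℝ) : Set (Obs p n) :=
  ⋃ t₀ ∈ Finset.Ico 1 n, changeSpaceAt p n s ρ t₀

/-- The law of the data matrix: independent columns `X_t ∼ N_p(θ_t, S)`. -/
def dataLaw {p n : ℕ} (S : Matrix (Fin p) (Fin p) ℝ) (θ : Obs p n) : Measure (Obs p n) :=
  Measure.pi fun t => multivariateGaussian (θ t) S

/-- The (randomized) tests: measurable functions of the data with values in `[0, 1]`. -/
def Tests (p n : ℕ) : Set (Obs p n → ℝ) :=
  {ψ | Measurable ψ ∧ ∀ x, ψ x ∈ Set.Icc (0 : ℝ) 1}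

/-- The worst-case Type I error plus the worst-case Type II error of the test `ψ`. -/
def totalError {p n : ℕ} (S : Matrix (Fin p) (Fin p) ℝ) (s : ℕ) (ρ : ℝ) (ψ : Obs p n → ℝ) : ℝ :=
  (⨆ θ : nullSpace p n, ∫ x, ψ x ∂(dataLaw S θ.1)) +
    ⨆ θ : changeSpace p n s ρ, ∫ x, (1 - ψ x) ∂(dataLaw S θ.1)

/-- The minimax testing error. -/
def minimaxError (p n : ℕ) (S : Matrix (Fin p) (Fin p) ℝ) (s : ℕ) (ρ : ℝ) : ℝ :=
  ⨅ ψ : Tests p n, totalError S s ρ ψ.1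

/-- `ρstar p n S` is the minimax rate of testing in the dense case `s = p`: the constants depend
on `ε` only, not on `p`, `n` or the covariance matrix `S`. -/
def IsDenseMinimaxRate (ρstar : (p n : ℕ) → Matrix (Fin p) (Fin p) ℝ → ℝ) : Prop :=
  (∀ ε ∈ Set.Ioo (0 : ℝ) 1, ∃ C₀ : ℝ, 0 < C₀ ∧
    ∀ (p n : ℕ) (S : Matrix (Fin p) (Fin p) ℝ), 1 ≤ p → 2 ≤ n → S.PosDef →
      ∀ C : ℝ, C₀ < C → minimaxError p n S p (C * ρstar p n S) ≤ ε) ∧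
  (∀ ε ∈ Set.Ioo (0 : ℝ) 1, ∃ c₀ : ℝ, 0 < c₀ ∧
    ∀ (p n : ℕ) (S : Matrix (Fin p) (Fin p) ℝ), 1 ≤ p → 2 ≤ n → S.PosDef →
      ∀ c ∈ Set.Ioo (0 : ℝ) c₀, 1 - ε ≤ minimaxError p n S p (c * ρstar p n S))

section
open scoped Matrix.Norms.Frobenius

/-- The Frobenius norm. -/
def frobNorm {p : ℕ} (S : Matrix (Fin p) (Fin p) ℝ) : ℝ := ‖S‖

end

section
open scoped Matrix.Norms.L2Operator

/-- The operator norm with respect to the Euclidean norm, that is, the largest singular value. -/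
def opNorm {p : ℕ} (S : Matrix (Fin p) (Fin p) ℝ) : ℝ := ‖S‖

end

/-- `‖S‖_F √(log log (8n)) ∨ ‖S‖_op log log (8n)`. -/
def rateSq (p n : ℕ) (S : Matrix (Fin p) (Fin p) ℝ) : ℝ :=
  max (frobNorm S * √(Real.log (Real.log (8 * (n : ℝ)))))
    (opNorm S * Real.log (Real.log (8 * (n : ℝ))))

end Changepoint

end

/-! Write `L = log log (8n)` and `R = rateSq p n S`. In the eigenbasis of `S` the noise has
independent coordinates whose variances are the eigenvalues, so `frobNorm S` and `opNorm S` are the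
ℓ² and ℓ^∞ norms of the eigenvalue vector.

Upper bound (`minimaxError_le_of_scan`): for each dyadic `t = 2 ^ i`, compare the first `t` with the
last `t` columns. The normalized contrast is `N(m, S)`, with `m = 0` without a change; for any
changepoint some dyadic `t` gives `‖m‖² ≥ ρ² / 4` (`exists_dyadic_contrast`). The test rejects when
some `‖y‖² - tr S` exceeds a multiple of `R`. There are only about `log n ≈ exp L` contrasts, and a
Chernoff bound for weighted chi-squares makes each tail small against `exp (-L)`.

Lower bound (`minimaxError_ge_of_prior`): mix over dyadic changepoints and random signs of the
eigen-coordinates. The second moment of the mixed likelihood ratio is an average of products of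
`cosh (2 * dyadicCorr i i' * b j)`. Correlations decay geometrically in `|i - i'|`, so their row
sums are bounded; convexity of `exp` makes the second moment linear in them, and `exp L = log (8n)`
is absorbed by the number of locations. The profile `b` depends on which norm dominates
(`exists_prior_profile`).

Uniqueness up to constants: one rate's upper bound and another's lower bound cannot both hold at the
same `ρ`, which forces two-sided comparison (`exists_le_mul_of_rates`). -/

namespace Changepoint

/-! ### Spectral form of the norms and of the Gaussian law -/

section Spectral

variable {p : ℕ} {S : Matrix (Fin p) (Fin p) ℝ}

theorem isHermitian_eq_unitary_mul_diagonal (hS : S.IsHermitian) :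
    S = (hS.eigenvectorUnitary : Matrix (Fin p) (Fin p) ℝ) * Matrix.diagonal hS.eigenvalues *
      star (hS.eigenvectorUnitary : Matrix (Fin p) (Fin p) ℝ) := by
  conv_lhs => rw [hS.spectral_theorem]
  rw [Unitary.conjStarAlgAut_apply]
  rfl

theorem frobNorm_sq_eq (hS : S.IsHermitian) : frobNorm S ^ 2 = ∑ j, hS.eigenvalues j ^ 2 := by
  have h1 : frobNorm S ^ 2 = ∑ i, ∑ j, S i j ^ 2 := by
    rw [frobNorm, Matrix.frobenius_norm_def, ← Real.sqrt_eq_rpow, Real.sq_sqrt (by positivity)]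
    simp
  have h2 : ∑ i, ∑ j, S i j ^ 2 = (S * S).trace := by
    simp only [Matrix.trace, Matrix.diag_apply, Matrix.mul_apply]
    refine Finset.sum_congr rfl fun i _ => Finset.sum_congr rfl fun j _ => ?_
    have := hS.apply i j
    simp only [star_trivial] at this
    rw [sq, this]
  have hU : star (hS.eigenvectorUnitary : Matrix (Fin p) (Fin p) ℝ) *
      (hS.eigenvectorUnitary : Matrix (Fin p) (Fin p) ℝ) = 1 := Unitary.coe_star_mul_self _
  rw [h1, h2]
  set U := (hS.eigenvectorUnitary : Matrix (Fin p) (Fin p) ℝ) with hUdef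
  have h3 : S * S = U * (Matrix.diagonal hS.eigenvalues * Matrix.diagonal hS.eigenvalues) *
      star U := by
    conv_lhs => rw [isHermitian_eq_unitary_mul_diagonal hS]
    rw [← hUdef]
    calc U * Matrix.diagonal hS.eigenvalues * star U * (U * Matrix.diagonal hS.eigenvalues * star U)
        = U * Matrix.diagonal hS.eigenvalues * (star U * U) * Matrix.diagonal hS.eigenvalues *
          star U := by simp only [mul_assoc]
      _ = _ := by rw [hU]; simp only [mul_assoc, one_mul]
  rw [h3, Matrix.trace_mul_comm, ← mul_assoc, hU, one_mul, Matrix.diagonal_mul_diagonal,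
    Matrix.trace_diagonal]
  exact Finset.sum_congr rfl fun j _ => (sq _).symm

open scoped Matrix.Norms.L2Operator in
theorem opNorm_eq (hS : S.IsHermitian) : opNorm S = ‖hS.eigenvalues‖ := by
  rw [opNorm]
  conv_lhs => rw [isHermitian_eq_unitary_mul_diagonal hS]
  have h : star (hS.eigenvectorUnitary : Matrix (Fin p) (Fin p) ℝ) =
    ((star hS.eigenvectorUnitary : Matrix.unitaryGroup (Fin p) ℝ) : Matrix (Fin p) (Fin p) ℝ) :=
    rfl
  rw [h, CStarRing.norm_mul_coe_unitary, CStarRing.norm_coe_unitary_mul, Matrix.l2_opNorm_diagonal]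

theorem eigenvalues_le_opNorm (hS : S.IsHermitian) (j : Fin p) : hS.eigenvalues j ≤ opNorm S := by
  rw [opNorm_eq hS]
  exact (Real.le_norm_self _).trans (norm_le_pi_norm _ j)

theorem exists_eigenvalues_eq_opNorm (hp : 1 ≤ p) (hS : S.PosDef) :
    ∃ j, hS.1.eigenvalues j = opNorm S := by
  have : Nonempty (Fin p) := ⟨⟨0, hp⟩⟩
  obtain ⟨j, hj⟩ := Finite.exists_max hS.1.eigenvalues
  refine ⟨j, le_antisymm (eigenvalues_le_opNorm hS.1 j) ?_⟩
  rw [opNorm_eq hS.1, pi_norm_le_iff_of_nonneg (hS.eigenvalues_pos j).le]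
  intro i
  rw [Real.norm_of_nonneg (hS.eigenvalues_pos i).le]
  exact hj i

theorem opNorm_pos (hp : 1 ≤ p) (hS : S.PosDef) : 0 < opNorm S := by
  obtain ⟨j, hj⟩ := exists_eigenvalues_eq_opNorm hp hS
  exact hj ▸ hS.eigenvalues_pos j

theorem frobNorm_nonneg (S : Matrix (Fin p) (Fin p) ℝ) : 0 ≤ frobNorm S := by
  rw [frobNorm, Matrix.frobenius_norm_def]
  positivity

-- Links the functional-calculus square root in the definition of `multivariateGaussian` to
-- eigen-coordinates, where the noise splits into independent scalars.
open scoped MatrixOrder in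
theorem sqrt_apply_eigenvectorBasis (hS : S.PosDef) (j : Fin p) :
    Matrix.toEuclideanCLM (𝕜 := ℝ) (CFC.sqrt S) (hS.1.eigenvectorBasis j) =
      √(hS.1.eigenvalues j) • hS.1.eigenvectorBasis j := by
  have h0 : (0 : Matrix (Fin p) (Fin p) ℝ) ≤ S := hS.posSemidef.nonneg
  have h1 : CFC.sqrt S = hS.1.cfc Real.sqrt := by
    rw [CFC.sqrt_eq_real_sqrt S h0, cfcₙ_eq_cfc, hS.1.cfc_eq]
  rw [h1]
  apply (WithLp.ofLp_injective 2)
  rw [Matrix.ofLp_toEuclideanCLM, Matrix.IsHermitian.cfc, Unitary.conjStarAlgAut_apply,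
    ← Matrix.mulVec_mulVec, ← Matrix.mulVec_mulVec,
    Matrix.IsHermitian.star_eigenvectorUnitary_mulVec]
  simp

theorem multivariateGaussian_eq_map (hS : S.PosDef) (m : EuclideanSpace ℝ (Fin p)) :
    multivariateGaussian m S = (Measure.pi fun _ : Fin p => gaussianReal 0 1).map
      (fun h => m + ∑ j, (√(hS.1.eigenvalues j) * h j) • hS.1.eigenvectorBasis j) := by
  rw [multivariateGaussian, stdGaussian_eq_map_pi_orthonormalBasis hS.1.eigenvectorBasis,
    Measure.map_map (by fun_prop) (by fun_prop)]
  congr 1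
  ext1 h
  simp only [Function.comp_apply, map_sum, map_smul]
  congr 1
  refine Finset.sum_congr rfl fun j _ => ?_
  rw [sqrt_apply_eigenvectorBasis hS, smul_smul, mul_comm]

end Spectral

end Changepoint

namespace Changepoint

/-! ### Chernoff bounds for linear and quadratic forms in Gaussians -/

section GaussianTails

theorem integral_exp_mul_sq_gaussianReal {c : ℝ} (hc : c < 1 / 2) :
    ∫ x, Real.exp (c * x ^ 2) ∂(gaussianReal 0 1) = (√(1 - 2 * c))⁻¹ := by
  rw [integral_gaussianReal_eq_integral_smul one_ne_zero]
  have h : ∀ x : ℝ, gaussianPDFReal 0 1 x • Real.exp (c * x ^ 2) =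
      (√(2 * Real.pi))⁻¹ * Real.exp (-(1 / 2 - c) * x ^ 2) := by
    intro x
    rw [gaussianPDFReal, smul_eq_mul, mul_assoc, ← Real.exp_add]
    simp only [NNReal.coe_one, mul_one, sub_zero]
    congr 2
    ring
  simp_rw [h]
  rw [integral_const_mul, integral_gaussian, ← Real.sqrt_inv, ← Real.sqrt_inv,
    ← Real.sqrt_mul (by positivity)]
  congr 1
  have : (1 / 2 - c) ≠ 0 := by linarith
  have h2 : (1 - 2 * c) ≠ 0 := by linarith
  have := Real.pi_pos.ne'
  field_simp

theorem integrable_exp_mul_sq_gaussianReal {c : ℝ} (hc : c < 1 / 2) :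
    Integrable (fun x => Real.exp (c * x ^ 2)) (gaussianReal 0 1) := by
  -- A non-integrable function has Bochner integral `0`, whereas the closed form is positive.
  by_contra h
  have h1 := integral_exp_mul_sq_gaussianReal hc
  rw [integral_undef h] at h1
  have : 0 < (√(1 - 2 * c))⁻¹ := inv_pos.2 (Real.sqrt_pos.2 (by linarith))
  linarith

theorem exp_neg_sub_sq_le {y : ℝ} (hy : |y| ≤ 1 / 2) : Real.exp (-y - 2 * y ^ 2) ≤ 1 - y := by
  have hx : 0 < 1 - y := by linarith [(abs_le.1 hy).2]
  rw [← Real.le_log_iff_exp_le hx]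
  have h := (abs_le.1 (Real.abs_log_sub_add_sum_range_le (x := y) (by linarith) 1)).1
  simp only [Finset.sum_range_one, zero_add, pow_one, Nat.cast_zero, div_one] at h
  have h2 : |y| ^ (1 + 1) / (1 - |y|) ≤ 2 * y ^ 2 := by
    rw [div_le_iff₀ (by linarith), one_add_one_eq_two, sq_abs]
    nlinarith [sq_nonneg y]
  linarith

/-- The exact value is `exp (-c) / √(1 - 2c)`; the quadratic lower bound on `log (1 - y)` at `y =
2c` controls it. -/
theorem integral_exp_mul_sq_sub_one_le {c : ℝ} (hc : |c| ≤ 1 / 4) :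
    ∫ x, Real.exp (c * (x ^ 2 - 1)) ∂(gaussianReal 0 1) ≤ Real.exp (4 * c ^ 2) := by
  have h := abs_le.1 hc
  have hc2 : c < 1 / 2 := by linarith [h.2]
  have h1 : ∀ x : ℝ, Real.exp (c * (x ^ 2 - 1)) = Real.exp (-c) * Real.exp (c * x ^ 2) := by
    intro x; rw [← Real.exp_add]; ring_nf
  simp_rw [h1]
  rw [integral_const_mul, integral_exp_mul_sq_gaussianReal hc2]
  have h2 : Real.exp (-c - 4 * c ^ 2) ≤ √(1 - 2 * c) := by
    apply Real.le_sqrt_of_sq_le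
    rw [sq, ← Real.exp_add]
    refine le_trans (le_of_eq ?_) (exp_neg_sub_sq_le (y := 2 * c) ?_)
    · ring_nf
    · rw [abs_mul, abs_two]; linarith
  have h3 : 0 < √(1 - 2 * c) := Real.sqrt_pos.2 (by linarith)
  rw [← div_eq_mul_inv, div_le_iff₀ h3]
  calc Real.exp (-c) = Real.exp (4 * c ^ 2) * Real.exp (-c - 4 * c ^ 2) := by
        rw [← Real.exp_add]; ring_nf
    _ ≤ _ := by gcongr

variable {ι : Type*} [Fintype ι]

/-- Chernoff at parameter `1`: the free slope is absorbed into `f`, and independence factors the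
exponential moment. -/
theorem measureReal_le_sum_le {μ : Measure ℝ} [IsProbabilityMeasure μ] {f : ι → ℝ → ℝ} {b : ι → ℝ}
    (hf : ∀ j, Integrable (fun y => Real.exp (f j y)) μ)
    (hb : ∀ j, ∫ y, Real.exp (f j y) ∂μ ≤ Real.exp (b j)) (x : ℝ) :
    (Measure.pi fun _ : ι => μ).real {h | x ≤ ∑ j, f j (h j)} ≤ Real.exp (∑ j, b j - x) := by
  have he : ∀ h : ι → ℝ, Real.exp (1 * ∑ j, f j (h j)) = ∏ j, Real.exp (f j (h j)) := fun h => by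
    rw [one_mul, Real.exp_sum]
  have hint : Integrable (fun h : ι → ℝ => Real.exp (1 * ∑ j, f j (h j)))
      (Measure.pi fun _ : ι => μ) := by
    simp_rw [he]
    exact Integrable.fintype_prod hf
  refine (measure_ge_le_exp_mul_mgf x zero_le_one hint).trans ?_
  rw [mgf]
  simp_rw [he]
  rw [integral_fintype_prod_eq_prod (fun j y => Real.exp (f j y)), sub_eq_neg_add, Real.exp_add,
    Real.exp_sum, neg_one_mul]
  exact mul_le_mul_of_nonneg_left (Finset.prod_le_prod
    (fun j _ => integral_nonneg fun y => (Real.exp_pos (f j y)).le) fun j _ => hb j)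
    (Real.exp_pos _).le

theorem measureReal_le_sum_mul_sq_sub_one_le {c : ι → ℝ} (hc : ∀ j, |c j| ≤ 1 / 4) (x : ℝ) :
    (Measure.pi fun _ : ι => gaussianReal 0 1).real {h | x ≤ ∑ j, c j * (h j ^ 2 - 1)} ≤
      Real.exp (4 * ∑ j, c j ^ 2 - x) := by
  rw [Finset.mul_sum]
  refine measureReal_le_sum_le (f := fun j y => c j * (y ^ 2 - 1)) (fun j => ?_)
    (fun j => integral_exp_mul_sq_sub_one_le (hc j)) x
  have h := (integrable_exp_mul_sq_gaussianReal (c := c j)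
    (by linarith [(abs_le.1 (hc j)).2])).const_mul (Real.exp (-c j))
  refine h.congr (Filter.Eventually.of_forall fun y => ?_)
  simp only [← Real.exp_add]
  ring_nf

theorem measureReal_le_sum_mul_le (d : ι → ℝ) (x : ℝ) :
    (Measure.pi fun _ : ι => gaussianReal 0 1).real {h | x ≤ ∑ j, d j * h j} ≤
      Real.exp ((∑ j, d j ^ 2) / 2 - x) := by
  rw [Finset.sum_div]
  refine measureReal_le_sum_le (f := fun j y => d j * y)
    (fun j => integrable_exp_mul_gaussianReal _) (fun j => le_of_eq ?_) x
  have := congrFun (mgf_id_gaussianReal (μ := 0) (v := 1)) (d j)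
  rw [mgf] at this
  simpa using this

end GaussianTails

/-! ### Likelihood ratios and whitening -/

section ChangeOfMeasure

theorem pi_withDensity {ι : Type*} [Fintype ι] {α : ι → Type*} [∀ i, MeasurableSpace (α i)]
    (μ : ∀ i, Measure (α i)) [∀ i, IsProbabilityMeasure (μ i)] {f : ∀ i, α i → ℝ}
    (h0 : ∀ i x, 0 ≤ f i x) (hint : ∀ i, Integrable (f i) (μ i)) :
    Measure.pi (fun i => (μ i).withDensity fun x => ENNReal.ofReal (f i x)) =
      (Measure.pi μ).withDensity fun x => ENNReal.ofReal (∏ i, f i (x i)) := by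
  have : ∀ i, IsFiniteMeasure ((μ i).withDensity fun x => ENNReal.ofReal (f i x)) := fun i =>
    isFiniteMeasure_withDensity_ofReal (hint i).2
  -- It suffices to compare boxes, where the indicator of the box times the product density factors
  -- over coordinates.
  refine Measure.pi_eq ?_
  intro s hs
  have h1 : ∀ x : ∀ i, α i, (Set.univ.pi s).indicator (fun x => ∏ i, f i (x i)) x =
      ∏ i, (s i).indicator (f i) (x i) := by
    intro x
    by_cases hx : x ∈ Set.univ.pi s
    · rw [Set.indicator_of_mem hx]
      exact Finset.prod_congr rfl fun i _ => (Set.indicator_of_mem (hx i trivial) _).symm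
    · rw [Set.indicator_of_notMem hx]
      obtain ⟨i, hi⟩ : ∃ i, x i ∉ s i := by simpa using hx
      exact (Finset.prod_eq_zero (Finset.mem_univ i) (Set.indicator_of_notMem hi _)).symm
  have hsp : MeasurableSet (Set.univ.pi s) := MeasurableSet.univ_pi hs
  have h2 : ∀ i, ((μ i).withDensity fun x => ENNReal.ofReal (f i x)) (s i) =
      ENNReal.ofReal (∫ x, (s i).indicator (f i) x ∂(μ i)) := by
    intro i
    rw [withDensity_apply _ (hs i), integral_indicator (hs i),
      ofReal_integral_eq_lintegral_ofReal (hint i).integrableOn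
        (Filter.Eventually.of_forall (h0 i))]
  have hpi : Integrable (fun x : ∀ i, α i => ∏ i, f i (x i)) (Measure.pi μ) :=
    Integrable.fintype_prod_dep hint
  rw [withDensity_apply _ hsp, ← ofReal_integral_eq_lintegral_ofReal hpi.integrableOn
        (Filter.Eventually.of_forall fun x => Finset.prod_nonneg fun i _ => h0 i _),
    ← integral_indicator hsp]
  simp_rw [h1, h2]
  rw [integral_fintype_prod_eq_prod (fun i x => (s i).indicator (f i) x),
    ENNReal.ofReal_prod_of_nonneg fun i _ => integral_nonneg fun x =>
      Set.indicator_nonneg (fun _ _ => h0 i _) _]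

theorem gaussianReal_eq_withDensity (η : ℝ) :
    gaussianReal η 1 = (gaussianReal 0 1).withDensity
      fun x => ENNReal.ofReal (Real.exp (η * x - η ^ 2 / 2)) := by
  rw [gaussianReal_of_var_ne_zero _ one_ne_zero, gaussianReal_of_var_ne_zero _ one_ne_zero,
    ← withDensity_mul _ (by fun_prop) (by fun_prop)]
  congr 1
  ext1 x
  rw [Pi.mul_apply, gaussianPDF, gaussianPDF, ← ENNReal.ofReal_mul (gaussianPDFReal_nonneg _ _ _),
    gaussianPDFReal, gaussianPDFReal, mul_assoc (√(2 * Real.pi * _))⁻¹, ← Real.exp_add]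
  congr 3
  simp
  ring

theorem integrable_exp_tilt (a b : ℝ) :
    Integrable (fun x => Real.exp (a * x - b)) (gaussianReal 0 1) := by
  simp_rw [sub_eq_add_neg, Real.exp_add]
  exact (integrable_exp_mul_gaussianReal a).mul_const _

theorem integral_exp_tilt (a b : ℝ) :
    ∫ x, Real.exp (a * x - b) ∂(gaussianReal 0 1) = Real.exp (a ^ 2 / 2 - b) := by
  simp_rw [sub_eq_add_neg, Real.exp_add]
  rw [integral_mul_const]
  have := congrFun (mgf_id_gaussianReal (μ := 0) (v := 1)) a
  rw [mgf] at this
  simp only [id] at this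
  rw [this]
  simp

/-- The likelihood ratio of independent unit variance Gaussians with means `η` against means `0`. -/
noncomputable def likelihood {p n : ℕ} (η g : Fin n → Fin p → ℝ) : ℝ :=
  ∏ t, ∏ j, Real.exp (η t j * g t j - η t j ^ 2 / 2)

/-- The law of an `n × p` array of independent standard Gaussians. -/
noncomputable abbrev stdArray (p n : ℕ) : Measure (Fin n → Fin p → ℝ) :=
  Measure.pi fun _ => Measure.pi fun _ => gaussianReal 0 1

variable {p n : ℕ}

theorem likelihood_pos (η g : Fin n → Fin p → ℝ) : 0 < likelihood η g :=
  Finset.prod_pos fun _ _ => Finset.prod_pos fun _ _ => Real.exp_pos _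

theorem measurable_likelihood (η : Fin n → Fin p → ℝ) : Measurable (likelihood η) := by
  unfold likelihood
  fun_prop

theorem likelihood_mul (η η' g : Fin n → Fin p → ℝ) :
    likelihood η g * likelihood η' g =
      ∏ t, ∏ j, Real.exp ((η t j + η' t j) * g t j - (η t j ^ 2 / 2 + η' t j ^ 2 / 2)) := by
  simp only [likelihood, ← Finset.prod_mul_distrib, ← Real.exp_add]
  refine Finset.prod_congr rfl fun t _ => Finset.prod_congr rfl fun j _ => ?_
  ring_nf

theorem integrable_prod_exp_tilt (a b : Fin n → Fin p → ℝ) :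
    Integrable (fun g => ∏ t, ∏ j, Real.exp (a t j * g t j - b t j)) (stdArray p n) :=
  Integrable.fintype_prod (f := fun t (y : Fin p → ℝ) => ∏ j, Real.exp (a t j * y j - b t j))
    fun t => Integrable.fintype_prod (f := fun j y => Real.exp (a t j * y - b t j))
      fun _ => integrable_exp_tilt _ _

theorem integral_prod_exp_tilt (a b : Fin n → Fin p → ℝ) :
    ∫ g, ∏ t, ∏ j, Real.exp (a t j * g t j - b t j) ∂(stdArray p n) =
      Real.exp (∑ t, ∑ j, (a t j ^ 2 / 2 - b t j)) := by
  rw [integral_fintype_prod_eq_prod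
    (fun t (y : Fin p → ℝ) => ∏ j, Real.exp (a t j * y j - b t j)), Real.exp_sum]
  refine Finset.prod_congr rfl fun t _ => ?_
  rw [integral_fintype_prod_eq_prod (fun j y => Real.exp (a t j * y - b t j)), Real.exp_sum]
  exact Finset.prod_congr rfl fun j _ => integral_exp_tilt _ _

theorem integrable_likelihood (η : Fin n → Fin p → ℝ) :
    Integrable (likelihood η) (stdArray p n) := integrable_prod_exp_tilt _ _

theorem integral_likelihood (η : Fin n → Fin p → ℝ) :
    ∫ g, likelihood η g ∂(stdArray p n) = 1 := by
  simp [likelihood, integral_prod_exp_tilt]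

theorem integrable_likelihood_mul (η η' : Fin n → Fin p → ℝ) :
    Integrable (fun g => likelihood η g * likelihood η' g) (stdArray p n) := by
  simp_rw [likelihood_mul]
  exact integrable_prod_exp_tilt _ _

theorem integral_likelihood_mul (η η' : Fin n → Fin p → ℝ) :
    ∫ g, likelihood η g * likelihood η' g ∂(stdArray p n) =
      Real.exp (∑ t, ∑ j, η t j * η' t j) := by
  simp_rw [likelihood_mul, integral_prod_exp_tilt]
  congr 1
  refine Finset.sum_congr rfl fun t _ => Finset.sum_congr rfl fun j _ => ?_
  ring

theorem pi_gaussianReal_eq_withDensity (η : Fin n → Fin p → ℝ) :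
    (Measure.pi fun t => Measure.pi fun j => gaussianReal (η t j) 1) =
      (stdArray p n).withDensity fun g => ENNReal.ofReal (likelihood η g) := by
  simp_rw [gaussianReal_eq_withDensity (η _ _)]
  have h : ∀ t, (Measure.pi fun j => (gaussianReal 0 1).withDensity
      fun x => ENNReal.ofReal (Real.exp (η t j * x - η t j ^ 2 / 2))) =
      (Measure.pi fun _ => gaussianReal 0 1).withDensity
        fun y => ENNReal.ofReal (∏ j, Real.exp (η t j * y j - η t j ^ 2 / 2)) := fun t =>
    pi_withDensity (fun _ => gaussianReal 0 1)
      (fun j x => (Real.exp_pos _).le) (fun j => integrable_exp_tilt _ _)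
  simp_rw [h]
  exact pi_withDensity (fun _ => Measure.pi fun _ => gaussianReal 0 1)
    (f := fun t y => ∏ j, Real.exp (η t j * y j - η t j ^ 2 / 2))
    (fun t y => Finset.prod_nonneg fun _ _ => (Real.exp_pos _).le)
    (fun t => Integrable.fintype_prod (f := fun j y => Real.exp (_ * y - _))
      fun _ => integrable_exp_tilt _ _)

/-- The array `g` in the eigenbasis coordinates scaled by the square roots of the eigenvalues. -/
noncomputable def colored {S : Matrix (Fin p) (Fin p) ℝ} (hS : S.PosDef) (g : Fin n → Fin p → ℝ) :
    Obs p n :=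
  fun t => ∑ j, (√(hS.1.eigenvalues j) * g t j) • hS.1.eigenvectorBasis j

theorem measurable_colored {S : Matrix (Fin p) (Fin p) ℝ} (hS : S.PosDef) :
    Measurable (colored (n := n) hS) := by
  unfold colored
  fun_prop

theorem dataLaw_colored {S : Matrix (Fin p) (Fin p) ℝ} (hS : S.PosDef) (η : Fin n → Fin p → ℝ) :
    dataLaw S (colored hS η) = (Measure.pi fun t => Measure.pi fun j => gaussianReal (η t j) 1).map
      (colored hS) := by
  have h : ∀ t, multivariateGaussian (colored hS η t) S =
      (Measure.pi fun j => gaussianReal (η t j) 1).map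
        (fun h => ∑ j, (√(hS.1.eigenvalues j) * h j) • hS.1.eigenvectorBasis j) := by
    intro t
    have h1 : (Measure.pi fun j => gaussianReal (η t j) 1) =
        (Measure.pi fun _ => gaussianReal 0 1).map (fun h j => η t j + h j) := by
      rw [Measure.pi_map_pi (fun j => by fun_prop)]
      congr 1
      ext1 j
      rw [gaussianReal_map_const_add, zero_add]
    rw [h1, Measure.map_map (by fun_prop) (by fun_prop), multivariateGaussian_eq_map hS]
    congr 1
    ext1 h
    simp only [colored, Function.comp_apply, mul_add, add_smul, Finset.sum_add_distrib]
  rw [dataLaw]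
  simp_rw [h]
  exact (Measure.pi_map_pi fun t => (by fun_prop : Measurable _).aemeasurable).symm

/-- All laws become densities against a single white-noise array, so `S` enters the lower bound only
through the signal strength. -/
theorem integral_dataLaw_colored {S : Matrix (Fin p) (Fin p) ℝ} (hS : S.PosDef)
    (η : Fin n → Fin p → ℝ) {f : Obs p n → ℝ} (hf : Measurable f) :
    ∫ x, f x ∂(dataLaw S (colored hS η)) =
      ∫ g, likelihood η g * f (colored hS g) ∂(stdArray p n) := by
  rw [dataLaw_colored, integral_map (measurable_colored hS).aemeasurable hf.aestronglyMeasurable,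
    pi_gaussianReal_eq_withDensity, integral_withDensity_eq_integral_toReal_smul
      (measurable_likelihood η).ennreal_ofReal (by simp)]
  simp_rw [ENNReal.toReal_ofReal (likelihood_pos η _).le, smul_eq_mul]

end ChangeOfMeasure

end Changepoint

namespace Changepoint

variable {p n : ℕ} {S : Matrix (Fin p) (Fin p) ℝ}

/-! ### Tails of the centred squared norm -/

section QuadraticTails

/-- The centred Gaussian vector built from its standardized coordinates in the eigenbasis. -/
noncomputable def coloredVec (hS : S.PosDef) (h : Fin p → ℝ) : EuclideanSpace ℝ (Fin p) :=
  ∑ j, (√(hS.1.eigenvalues j) * h j) • hS.1.eigenvectorBasis j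

theorem norm_sq_sum_smul_orthonormalBasis {E : Type*} [NormedAddCommGroup E]
    [InnerProductSpace ℝ E] (v : OrthonormalBasis (Fin p) ℝ E) (a : Fin p → ℝ) :
    ‖∑ j, a j • v j‖ ^ 2 = ∑ j, a j ^ 2 := by
  rw [← real_inner_self_eq_norm_sq, v.orthonormal.inner_sum]
  simp [sq]

theorem norm_sq_coloredVec (hS : S.PosDef) (h : Fin p → ℝ) :
    ‖coloredVec hS h‖ ^ 2 = ∑ j, hS.1.eigenvalues j * h j ^ 2 := by
  rw [coloredVec, norm_sq_sum_smul_orthonormalBasis]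
  refine Finset.sum_congr rfl fun j _ => ?_
  rw [mul_pow, Real.sq_sqrt (hS.eigenvalues_pos j).le]

theorem norm_sq_coloredVec_sub_trace (hS : S.PosDef) (h : Fin p → ℝ) :
    ‖coloredVec hS h‖ ^ 2 - S.trace = ∑ j, hS.1.eigenvalues j * (h j ^ 2 - 1) := by
  rw [norm_sq_coloredVec, hS.1.trace_eq_sum_eigenvalues, ← Finset.sum_sub_distrib]
  refine Finset.sum_congr rfl fun j _ => ?_
  simp
  ring

theorem multivariateGaussian_real (hS : S.PosDef) (m : EuclideanSpace ℝ (Fin p))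
    {A : Set (EuclideanSpace ℝ (Fin p))} (hA : MeasurableSet A) :
    (multivariateGaussian m S).real A = (Measure.pi fun _ : Fin p => gaussianReal 0 1).real
      {h | m + coloredVec hS h ∈ A} := by
  rw [multivariateGaussian_eq_map hS, map_measureReal_apply (by fun_prop) hA]
  rfl

variable {l : ℝ}

theorem measureReal_le_norm_sq_sub_trace_le (hS : S.PosDef) (hl0 : 0 ≤ l)
    (hl : l * opNorm S ≤ 1 / 4) (u : ℝ) :
    (Measure.pi fun _ : Fin p => gaussianReal 0 1).real {h | u ≤ ‖coloredVec hS h‖ ^ 2 - S.trace} ≤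
      Real.exp (4 * (l ^ 2 * frobNorm S ^ 2) - l * u) := by
  have hc : ∀ j, |l * hS.1.eigenvalues j| ≤ 1 / 4 := fun j => by
    rw [abs_of_nonneg (mul_nonneg hl0 (hS.eigenvalues_pos j).le)]
    exact (mul_le_mul_of_nonneg_left (eigenvalues_le_opNorm hS.1 j) hl0).trans hl
  have h := measureReal_le_sum_mul_sq_sub_one_le hc (l * u)
  simp only [mul_pow, ← Finset.mul_sum, ← frobNorm_sq_eq hS.1] at h
  refine (measureReal_mono fun x hx => ?_).trans h
  simp only [Set.mem_ofPred_eq, norm_sq_coloredVec_sub_trace] at hx ⊢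
  simp only [mul_assoc, ← Finset.mul_sum]
  exact mul_le_mul_of_nonneg_left hx hl0

theorem measureReal_norm_sq_sub_trace_le_neg_le (hS : S.PosDef) (hl0 : 0 ≤ l)
    (hl : l * opNorm S ≤ 1 / 4) (u : ℝ) :
    (Measure.pi fun _ : Fin p => gaussianReal 0 1).real
        {h | ‖coloredVec hS h‖ ^ 2 - S.trace ≤ -u} ≤
      Real.exp (4 * (l ^ 2 * frobNorm S ^ 2) - l * u) := by
  have hc : ∀ j, |-l * hS.1.eigenvalues j| ≤ 1 / 4 := fun j => by
    rw [neg_mul, abs_neg, abs_of_nonneg (mul_nonneg hl0 (hS.eigenvalues_pos j).le)]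
    exact (mul_le_mul_of_nonneg_left (eigenvalues_le_opNorm hS.1 j) hl0).trans hl
  have h := measureReal_le_sum_mul_sq_sub_one_le hc (l * u)
  simp only [mul_pow, neg_sq, ← Finset.mul_sum, ← frobNorm_sq_eq hS.1] at h
  refine (measureReal_mono fun x hx => ?_).trans h
  simp only [Set.mem_ofPred_eq, norm_sq_coloredVec_sub_trace] at hx ⊢
  simp only [mul_assoc, ← Finset.mul_sum]
  nlinarith

theorem measureReal_inner_le_neg_le (hS : S.PosDef) (hl0 : 0 ≤ l) (m : EuclideanSpace ℝ (Fin p))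
    (v : ℝ) :
    (Measure.pi fun _ : Fin p => gaussianReal 0 1).real {h | inner ℝ m (coloredVec hS h) ≤ -v} ≤
      Real.exp (l ^ 2 * (opNorm S * ‖m‖ ^ 2) / 2 - l * v) := by
  set d : Fin p → ℝ := fun j =>
    -l * (√(hS.1.eigenvalues j) * inner ℝ m (hS.1.eigenvectorBasis j)) with hd
  have hsum : ∑ j, d j ^ 2 ≤ l ^ 2 * (opNorm S * ‖m‖ ^ 2) := by
    rw [← hS.1.eigenvectorBasis.sum_sq_inner_left m, Finset.mul_sum, Finset.mul_sum]
    refine Finset.sum_le_sum fun j _ => ?_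
    rw [hd]
    simp only [mul_pow, neg_sq]
    rw [Real.sq_sqrt (hS.eigenvalues_pos j).le]
    gcongr
    exact eigenvalues_le_opNorm hS.1 j
  refine (measureReal_mono fun x hx => ?_).trans
    ((measureReal_le_sum_mul_le d (l * v)).trans (Real.exp_le_exp.2 (by linarith)))
  have h1 : ∑ j, d j * x j = -l * inner ℝ m (coloredVec hS x) := by
    rw [coloredVec, inner_sum, Finset.mul_sum]
    refine Finset.sum_congr rfl fun j _ => ?_
    rw [inner_smul_right, hd]
    ring
  simp only [Set.mem_ofPred_eq] at hx ⊢
  rw [h1]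
  nlinarith

/-- Under zero mean, the centred quadratic statistic rarely exceeds the threshold. -/
theorem multivariateGaussian_zero_exceed_le (hS : S.PosDef) (hl0 : 0 ≤ l)
    (hl : l * opNorm S ≤ 1 / 4) (u : ℝ) :
    (multivariateGaussian 0 S).real {y | u < ‖y‖ ^ 2 - S.trace} ≤
      Real.exp (4 * (l ^ 2 * frobNorm S ^ 2) - l * u) := by
  rw [multivariateGaussian_real hS 0 (measurableSet_lt (by fun_prop) (by fun_prop))]
  refine (measureReal_mono fun x hx => ?_).trans (measureReal_le_norm_sq_sub_trace_le hS hl0 hl u)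
  simp only [Set.mem_ofPred_eq, zero_add] at hx ⊢
  exact hx.le

/-- The threshold is exceeded with high probability if the mean is large. -/
theorem multivariateGaussian_not_exceed_le (hS : S.PosDef) (hl0 : 0 ≤ l)
    (hl : l * opNorm S ≤ 1 / 4) {u : ℝ} {m : EuclideanSpace ℝ (Fin p)} (hm : 4 * u ≤ ‖m‖ ^ 2) :
    (multivariateGaussian m S).real {y | ‖y‖ ^ 2 - S.trace ≤ u} ≤
      Real.exp (4 * (l ^ 2 * frobNorm S ^ 2) - l * u) + Real.exp (-(l * u / 2)) := by
  rw [multivariateGaussian_real hS m (measurableSet_le (by fun_prop) (by fun_prop))]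
  -- In `‖m + Z‖² = ‖m‖² + 2⟨m, Z⟩ + ‖Z‖²`, if neither noise term is very negative then the centred
  -- statistic exceeds `‖m‖² / 2 - u ≥ u`.
  have hsub : {h | m + coloredVec hS h ∈ {y | ‖y‖ ^ 2 - S.trace ≤ u}} ⊆
      {h | ‖coloredVec hS h‖ ^ 2 - S.trace ≤ -u} ∪
        {h | inner ℝ m (coloredVec hS h) ≤ -(‖m‖ ^ 2 / 4)} := by
    intro h hh
    simp only [Set.mem_ofPred_eq, Set.mem_union] at hh ⊢
    rw [norm_add_sq_real] at hh
    by_contra! hcon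
    linarith [hcon.1, hcon.2]
  refine (measureReal_mono hsub).trans ((measureReal_union_le _ _).trans ?_)
  refine add_le_add (measureReal_norm_sq_sub_trace_le_neg_le hS hl0 hl u) ?_
  refine (measureReal_inner_le_neg_le hS hl0 m _).trans (Real.exp_le_exp.2 ?_)
  have h1 : l * (l * opNorm S) * ‖m‖ ^ 2 ≤ l * (1 / 4) * ‖m‖ ^ 2 := by gcongr
  have h2 : l * (4 * u) ≤ l * ‖m‖ ^ 2 := by gcongr
  linarith

end QuadraticTails

instance isProbabilityMeasure_dataLaw (θ : Obs p n) : IsProbabilityMeasure (dataLaw S θ) := by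
  unfold dataLaw
  infer_instance

/-! ### Dyadic contrasts -/

section Contrast

/-- By characteristic functions: the covariance is multiplied by `∑ w s ^ 2 = 1`, so every contrast
has noise covariance exactly `S`. -/
theorem map_sum_smul_dataLaw (hS : S.PosDef) (θ : Obs p n) {w : Fin n → ℝ}
    (hw : ∑ s, w s ^ 2 = 1) :
    (dataLaw S θ).map (fun x => ∑ s, w s • x s) = multivariateGaussian (∑ s, w s • θ s) S := by
  have h1 : (dataLaw S θ).map (fun x => ∑ s, w s • x s) =
      (Measure.pi fun s => (multivariateGaussian (θ s) S).map fun y => w s • y).map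
        (fun x => ∑ s, x s) := by
    rw [← Measure.pi_map_pi (fun s => by fun_prop), Measure.map_map (by fun_prop) (by fun_prop)]
    rfl
  have : ∀ s, IsProbabilityMeasure ((multivariateGaussian (θ s) S).map fun y => w s • y) :=
    fun s => Measure.isProbabilityMeasure_map (by fun_prop)
  have : IsProbabilityMeasure ((dataLaw S θ).map fun x => ∑ s, w s • x s) :=
    Measure.isProbabilityMeasure_map (by fun_prop : Measurable _).aemeasurable
  apply Measure.ext_of_charFun
  rw [h1, charFun_map_sum_pi_eq_prod]
  ext x
  rw [Finset.prod_apply, charFun_multivariateGaussian hS.posSemidef]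
  simp_rw [charFun_map_smul, charFun_multivariateGaussian hS.posSemidef]
  rw [← Complex.exp_sum, Finset.sum_sub_distrib, inner_sum]
  congr 2
  · simp only [real_inner_smul_left, real_inner_smul_right, Complex.ofReal_sum, Finset.sum_mul]
  · have : ∀ s, ((w s • x).ofLp ⬝ᵥ S.mulVec (w s • x).ofLp) =
        w s ^ 2 * (x.ofLp ⬝ᵥ S.mulVec x.ofLp) := by
      intro s
      simp [Matrix.mulVec_smul, sq, mul_assoc]
    simp_rw [this, ← Finset.sum_div]
    norm_cast
    rw [← Finset.sum_mul, hw, one_mul]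

/-- The contrast of the first `t` with the last `t` observations. -/
noncomputable def contrast (n t : ℕ) (s : Fin n) : ℝ :=
  (√(2 * t))⁻¹ * ((if (s : ℕ) < t then 1 else 0) - if (s : ℕ) < n - t then 0 else 1)

theorem sum_ite_lt {t : ℕ} (ht : t ≤ n) :
    ∑ s : Fin n, (if (s : ℕ) < t then (1 : ℝ) else 0) = t := by
  rw [Finset.sum_boole, Fin.card_filter_val_lt, min_eq_right ht]

theorem sum_ite_not_lt {t : ℕ} (ht : t ≤ n) :
    ∑ s : Fin n, (if (s : ℕ) < n - t then (0 : ℝ) else 1) = t := by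
  have h : ∀ s : Fin n, (if (s : ℕ) < n - t then (0 : ℝ) else 1) =
      1 - if (s : ℕ) < n - t then (1 : ℝ) else 0 := fun s => by split_ifs <;> simp
  simp_rw [h]
  rw [Finset.sum_sub_distrib, sum_ite_lt (Nat.sub_le _ _)]
  simp [Nat.cast_sub ht]

theorem sum_contrast {t : ℕ} (ht : t ≤ n) : ∑ s, contrast n t s = 0 := by
  simp only [contrast]
  rw [← Finset.mul_sum, Finset.sum_sub_distrib, sum_ite_lt ht, sum_ite_not_lt ht, sub_self,
    mul_zero]

theorem sum_contrast_sq {t : ℕ} (ht0 : 0 < t) (ht : 2 * t ≤ n) : ∑ s, contrast n t s ^ 2 = 1 := by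
  have h : ∀ s : Fin n, contrast n t s ^ 2 = (2 * t : ℝ)⁻¹ *
      ((if (s : ℕ) < t then 1 else 0) + if (s : ℕ) < n - t then 0 else 1) := by
    intro s
    rw [contrast, mul_pow, inv_pow, Real.sq_sqrt (by positivity)]
    congr 1
    split_ifs <;> first | omega | norm_num
  simp_rw [h]
  rw [← Finset.mul_sum, Finset.sum_add_distrib, sum_ite_lt (by omega), sum_ite_not_lt (by omega)]
  have : (0 : ℝ) < t := by exact_mod_cast ht0
  field_simp
  ring

theorem sum_contrast_smul_of_mem_nullSpace {t : ℕ} (ht : t ≤ n) {θ : Obs p n}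
    (hθ : θ ∈ nullSpace p n) : ∑ s, contrast n t s • θ s = 0 := by
  obtain ⟨μ, hμ⟩ := hθ
  simp_rw [hμ]
  rw [← Finset.sum_smul, sum_contrast ht, zero_smul]

/-- Taking blocks at the two ends keeps each on one side of the change, so `t₀` itself need not be
known. -/
theorem sum_contrast_smul_of_change {t t₀ : ℕ} (h1 : t ≤ t₀) (h2 : t₀ + t ≤ n) {θ : Obs p n}
    {μ₁ μ₂ : EuclideanSpace ℝ (Fin p)} (hμ₁ : ∀ i : Fin n, (i : ℕ) < t₀ → θ i = μ₁)
    (hμ₂ : ∀ i : Fin n, t₀ ≤ (i : ℕ) → θ i = μ₂) :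
    ∑ s, contrast n t s • θ s = ((√(2 * t))⁻¹ * t) • (μ₁ - μ₂) := by
  have h : ∀ s : Fin n, contrast n t s • θ s = (√(2 * t))⁻¹ •
      ((if (s : ℕ) < t then (1 : ℝ) else 0) • μ₁ -
        (if (s : ℕ) < n - t then (0 : ℝ) else 1) • μ₂) := by
    intro s
    rw [contrast, mul_smul]
    congr 1
    rw [sub_smul]
    congr 1
    · split_ifs with hs
      · rw [hμ₁ s (by omega)]
      · simp
    · split_ifs with hs
      · simp
      · rw [hμ₂ s (by omega)]
  simp_rw [h]
  rw [← Finset.smul_sum, Finset.sum_sub_distrib, ← Finset.sum_smul, ← Finset.sum_smul,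
    sum_ite_lt (by omega), sum_ite_not_lt (by omega), ← smul_sub, smul_smul]

theorem exists_dyadic_contrast {ρ : ℝ} {θ : Obs p n} (hθ : θ ∈ changeSpace p n p ρ) :
    ∃ i < Nat.log 2 n, ρ ^ 2 / 4 ≤ ‖∑ s, contrast n (2 ^ i) s • θ s‖ ^ 2 := by
  simp only [changeSpace, Set.mem_iUnion, Finset.mem_Ico] at hθ
  obtain ⟨t₀, ⟨ht1, htn⟩, μ₁, μ₂, hμ₁, hμ₂, -, hρ⟩ := hθ
  -- The largest power of two below `q` loses a factor at most `2`, and `t₀ (n - t₀) / n ≤ q`; the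
  -- normalization of the contrast costs the other factor `2` in `ρ ^ 2 / 4`.
  set q := min t₀ (n - t₀) with hq
  have hq0 : q ≠ 0 := by omega
  set i := Nat.log 2 q with hi
  have hle : 2 ^ i ≤ q := Nat.pow_log_le_self 2 hq0
  have hlt : q < 2 ^ (i + 1) := Nat.lt_pow_succ_log_self one_lt_two q
  have hin : 2 ^ (i + 1) ≤ n := by rw [pow_succ]; omega
  refine ⟨i, Nat.lt_of_succ_le (Nat.le_log_of_pow_le one_lt_two hin), ?_⟩
  rw [sum_contrast_smul_of_change (t₀ := t₀) (by omega) (by omega) hμ₁ hμ₂, norm_smul, mul_pow]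
  have h2 : (0 : ℝ) < 2 ^ i := by positivity
  have h3 : ‖(√(2 * ((2 ^ i : ℕ) : ℝ)))⁻¹ * ((2 ^ i : ℕ) : ℝ)‖ ^ 2 = 2 ^ i / 2 := by
    rw [Real.norm_eq_abs, sq_abs, mul_pow, inv_pow, Real.sq_sqrt (by positivity)]
    push_cast
    field_simp
  rw [h3]
  have hn : (0 : ℝ) < n := by exact_mod_cast (by omega : 0 < n)
  have h4 : (t₀ : ℝ) * (n - t₀) / n ≤ 2 * 2 ^ i := by
    have hq2 : (q : ℝ) ≤ 2 * 2 ^ i := by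
      have : q ≤ 2 * 2 ^ i := by rw [pow_succ] at hlt; omega
      exact_mod_cast this
    have ht0 : (0 : ℝ) ≤ t₀ := by positivity
    have ht0n : (t₀ : ℝ) ≤ n := by exact_mod_cast htn.le
    refine le_trans ?_ hq2
    rw [div_le_iff₀ hn]
    rcases le_total t₀ (n - t₀) with h | h
    · rw [hq, min_eq_left h]
      nlinarith
    · rw [hq, min_eq_right h, Nat.cast_sub htn.le]
      nlinarith
  have h5 := hρ.trans (mul_le_mul_of_nonneg_right h4 (sq_nonneg ‖μ₁ - μ₂‖))
  linarith

end Contrast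

/-! ### Upper bound by the scan test -/

theorem integral_test_mem_Icc {ψ : Obs p n → ℝ} (hψ : ψ ∈ Tests p n) (θ : Obs p n) :
    ∫ x, ψ x ∂(dataLaw S θ) ∈ Set.Icc (0 : ℝ) 1 := by
  refine ⟨integral_nonneg fun x => (hψ.2 x).1, ?_⟩
  refine (integral_mono_of_nonneg (Filter.Eventually.of_forall fun x => (hψ.2 x).1)
    (integrable_const 1) (Filter.Eventually.of_forall fun x => (hψ.2 x).2)).trans ?_
  simp

theorem one_sub_mem_Tests {ψ : Obs p n → ℝ} (hψ : ψ ∈ Tests p n) :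
    (fun x => 1 - ψ x) ∈ Tests p n :=
  ⟨measurable_const.sub hψ.1, fun x => ⟨by linarith [(hψ.2 x).2], by linarith [(hψ.2 x).1]⟩⟩

theorem totalError_nonneg {s : ℕ} {ρ : ℝ} {ψ : Obs p n → ℝ} (hψ : ψ ∈ Tests p n) :
    0 ≤ totalError S s ρ ψ :=
  add_nonneg (Real.iSup_nonneg fun θ => (integral_test_mem_Icc hψ θ.1).1)
    (Real.iSup_nonneg fun θ => (integral_test_mem_Icc (one_sub_mem_Tests hψ) θ.1).1)

theorem minimaxError_le {s : ℕ} {ρ : ℝ} {ψ : Obs p n → ℝ} (hψ : ψ ∈ Tests p n) {a b : ℝ}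
    (ha : 0 ≤ a) (hb : 0 ≤ b) (h0 : ∀ θ ∈ nullSpace p n, ∫ x, ψ x ∂(dataLaw S θ) ≤ a)
    (h1 : ∀ θ ∈ changeSpace p n s ρ, ∫ x, (1 - ψ x) ∂(dataLaw S θ) ≤ b) :
    minimaxError p n S s ρ ≤ a + b := by
  refine (ciInf_le ⟨0, ?_⟩ (⟨ψ, hψ⟩ : Tests p n)).trans ?_
  · rintro _ ⟨φ, rfl⟩
    exact totalError_nonneg φ.2
  · exact add_le_add (Real.iSup_le (fun θ => h0 θ.1 θ.2) ha)
      (Real.iSup_le (fun θ => h1 θ.1 θ.2) hb)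

/-- The factor `8` is just enough: `8n ≥ 16`, and `log 16 = 4 log 2 ≈ 2.77` exceeds `e`. -/
theorem one_le_loglog (hn : 2 ≤ n) : 1 ≤ Real.log (Real.log (8 * (n : ℝ))) := by
  have h1 : (2 : ℝ) ≤ n := by exact_mod_cast hn
  have h2 : Real.log 16 ≤ Real.log (8 * n) := Real.log_le_log (by norm_num) (by linarith)
  have h3 : Real.log 16 = 4 * Real.log 2 := by
    rw [show (16 : ℝ) = 2 ^ 4 by norm_num, Real.log_pow]
    norm_num
  have h4 := Real.log_two_gt_d9
  have h5 := Real.exp_one_lt_d9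
  rw [Real.le_log_iff_exp_le (by linarith)]
  linarith

theorem exp_loglog (hn : 2 ≤ n) :
    Real.exp (Real.log (Real.log (8 * (n : ℝ)))) = Real.log (8 * n) := by
  have h1 : (2 : ℝ) ≤ n := by exact_mod_cast hn
  exact Real.exp_log (Real.log_pos (by linarith))

theorem natLog_le_exp_loglog (hn : 2 ≤ n) :
    (Nat.log 2 n : ℝ) ≤ 2 * Real.exp (Real.log (Real.log (8 * (n : ℝ)))) := by
  have h1 : (2 : ℝ) ≤ n := by exact_mod_cast hn
  rw [exp_loglog hn]
  have h2 : Real.log ((2 : ℝ) ^ Nat.log 2 n) ≤ Real.log (8 * n) := by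
    apply Real.log_le_log (by positivity)
    have : ((2 ^ Nat.log 2 n : ℕ) : ℝ) ≤ n := by
      exact_mod_cast Nat.pow_log_le_self 2 (by omega : n ≠ 0)
    push_cast at this
    linarith
  rw [Real.log_pow] at h2
  have h4 := Real.log_two_gt_d9
  nlinarith [Nat.cast_nonneg (α := ℝ) (Nat.log 2 n)]

theorem rateSq_pos (hp : 1 ≤ p) (hn : 2 ≤ n) (hS : S.PosDef) : 0 < rateSq p n S :=
  lt_of_lt_of_le (mul_pos (opNorm_pos hp hS) (by linarith [one_le_loglog hn])) (le_max_right _ _)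

/-- The data for which some dyadic contrast exceeds the threshold. -/
def scanSet (p n : ℕ) (S : Matrix (Fin p) (Fin p) ℝ) (u : ℝ) : Set (Obs p n) :=
  ⋃ i ∈ Finset.range (Nat.log 2 n),
    {x | u < ‖∑ s, contrast n (2 ^ i) s • x s‖ ^ 2 - S.trace}

theorem measurableSet_exceed (w : Fin n → ℝ) (u a : ℝ) :
    MeasurableSet {x : Obs p n | u < ‖∑ s, w s • x s‖ ^ 2 - a} :=
  measurableSet_lt (by fun_prop) (by fun_prop)

theorem measurableSet_scanSet (u : ℝ) : MeasurableSet (scanSet p n S u) :=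
  Finset.measurableSet_biUnion _ fun _ _ => measurableSet_exceed _ _ _

theorem two_mul_pow_le {i : ℕ} (hi : i < Nat.log 2 n) : 2 * 2 ^ i ≤ n := by
  have h0 : n ≠ 0 := by rintro rfl; simp at hi
  calc 2 * 2 ^ i = 2 ^ (i + 1) := by ring
    _ ≤ 2 ^ Nat.log 2 n := Nat.pow_le_pow_right two_pos hi
    _ ≤ n := Nat.pow_log_le_self 2 h0

theorem dataLaw_scanSet_le (hS : S.PosDef) {l : ℝ} (hl0 : 0 ≤ l) (hl : l * opNorm S ≤ 1 / 4)
    (u : ℝ) {θ : Obs p n} (hθ : θ ∈ nullSpace p n) :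
    (dataLaw S θ).real (scanSet p n S u) ≤
      Nat.log 2 n * Real.exp (4 * (l ^ 2 * frobNorm S ^ 2) - l * u) := by
  refine (measureReal_biUnion_finset_le _ _).trans ?_
  refine (Finset.sum_le_card_nsmul _ _ _ fun i hi => ?_).trans_eq
    (by rw [Finset.card_range, nsmul_eq_mul])
  have h2 := two_mul_pow_le (Finset.mem_range.1 hi)
  have h := multivariateGaussian_zero_exceed_le hS hl0 hl u
  rw [← sum_contrast_smul_of_mem_nullSpace (t := 2 ^ i) (by omega) hθ,
    ← map_sum_smul_dataLaw hS θ (sum_contrast_sq (by positivity) h2),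
    map_measureReal_apply (by fun_prop) (measurableSet_lt (by fun_prop) (by fun_prop))] at h
  exact h

theorem dataLaw_compl_scanSet_le (hS : S.PosDef) {l : ℝ} (hl0 : 0 ≤ l)
    (hl : l * opNorm S ≤ 1 / 4) {u ρ : ℝ} (hu : 16 * u ≤ ρ ^ 2) {θ : Obs p n}
    (hθ : θ ∈ changeSpace p n p ρ) :
    (dataLaw S θ).real (scanSet p n S u)ᶜ ≤
      Real.exp (4 * (l ^ 2 * frobNorm S ^ 2) - l * u) + Real.exp (-(l * u / 2)) := by
  obtain ⟨i, hi, hm⟩ := exists_dyadic_contrast hθ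
  have h := multivariateGaussian_not_exceed_le hS hl0 hl (u := u)
    (m := ∑ s, contrast n (2 ^ i) s • θ s) (by linarith)
  rw [← map_sum_smul_dataLaw hS θ (sum_contrast_sq (by positivity) (two_mul_pow_le hi)),
    map_measureReal_apply (by fun_prop) (measurableSet_le (by fun_prop) (by fun_prop))] at h
  refine (measureReal_mono fun x hx => ?_).trans h
  simp only [scanSet, Set.mem_compl_iff, Set.mem_iUnion, Finset.mem_range, not_exists,
    Set.mem_ofPred_eq, not_lt] at hx
  exact hx i hi

theorem minimaxError_le_of_scan (hp : 1 ≤ p) (hn : 2 ≤ n) (hS : S.PosDef) {K ρ : ℝ} (hK : 16 ≤ K)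
    (hρ : 16 * (K * rateSq p n S) ≤ ρ ^ 2) :
    minimaxError p n S p ρ ≤ 4 * Real.exp (2 - K / 8) := by
  set L := Real.log (Real.log (8 * (n : ℝ))) with hL
  set R := rateSq p n S with hR
  have hL1 : 1 ≤ L := one_le_loglog hn
  have hR0 : 0 < R := rateSq_pos hp hn hS
  -- This Chernoff slope serves both regimes: `opNorm S * L ≤ R` keeps it admissible, and `frobNorm
  -- S * √L ≤ R` bounds the variance term by `L / 4`. With threshold `K * R` the gain is `K * L /
  -- 4`.
  set l := L / (4 * R) with hl
  have hl0 : 0 ≤ l := by positivity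
  have hlR : l * R = L / 4 := by rw [hl]; field_simp
  have hop : opNorm S * L ≤ R := le_max_right _ _
  have hfr : frobNorm S * √L ≤ R := le_max_left _ _
  have hlop : l * opNorm S ≤ 1 / 4 := by
    rw [hl, div_mul_eq_mul_div, div_le_iff₀ (by positivity)]
    linarith
  have hlF : 4 * (l ^ 2 * frobNorm S ^ 2) ≤ L / 4 := by
    have h1 : (frobNorm S * √L) ^ 2 ≤ R ^ 2 :=
      pow_le_pow_left₀ (mul_nonneg (frobNorm_nonneg S) (Real.sqrt_nonneg _)) hfr 2
    rw [mul_pow, Real.sq_sqrt (by linarith)] at h1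
    have h2 : l ^ 2 * (frobNorm S ^ 2 * L) ≤ l ^ 2 * R ^ 2 := by gcongr
    have h3 : l ^ 2 * R ^ 2 = L ^ 2 / 16 := by rw [← mul_pow, hlR]; ring
    have h4 : (l ^ 2 * frobNorm S ^ 2) * L ≤ (L / 16) * L := by nlinarith
    linarith [le_of_mul_le_mul_right h4 (by linarith)]
  have hlu : l * (K * R) = K * L / 4 := by
    rw [mul_left_comm, hlR]; ring
  set e := Real.exp (2 - K / 8) with he
  have hψ : (scanSet p n S (K * R)).indicator 1 ∈ Tests p n :=
    ⟨measurable_one.indicator (measurableSet_scanSet _), fun x => by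
      by_cases hx : x ∈ scanSet p n S (K * R) <;> simp [hx]⟩
  have hb : 4 * e = 2 * e + 2 * e := by ring
  rw [hb]
  have hKL : K ≤ K * L := by nlinarith
  -- The factor `exp (-L)` pays for the union bound over at most `2 * exp L` dyadic scales.
  have hb1 : Real.exp (4 * (l ^ 2 * frobNorm S ^ 2) - l * (K * R)) ≤ Real.exp (-L) * e := by
    rw [he, ← Real.exp_add]
    apply Real.exp_le_exp.2
    rw [hlu]
    nlinarith
  refine minimaxError_le hψ (by positivity) (by positivity) (fun θ hθ => ?_) (fun θ hθ => ?_)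
  · rw [integral_indicator_one (measurableSet_scanSet _)]
    refine (dataLaw_scanSet_le hS hl0 hlop _ hθ).trans ?_
    calc (Nat.log 2 n : ℝ) * Real.exp (4 * (l ^ 2 * frobNorm S ^ 2) - l * (K * R))
        ≤ (2 * Real.exp L) * (Real.exp (-L) * e) := by
          gcongr
          exact natLog_le_exp_loglog hn
      _ = 2 * e * (Real.exp L * Real.exp (-L)) := by ring
      _ = 2 * e := by rw [← Real.exp_add]; simp
  · have h1 : ∀ x : Obs p n, 1 - (scanSet p n S (K * R)).indicator 1 x =
        (scanSet p n S (K * R))ᶜ.indicator (1 : Obs p n → ℝ) x := fun x => by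
      by_cases hx : x ∈ scanSet p n S (K * R) <;> simp [hx]
    simp_rw [h1]
    rw [integral_indicator_one (measurableSet_scanSet _).compl]
    refine (dataLaw_compl_scanSet_le hS hl0 hlop hρ hθ).trans ?_
    have hb2 : Real.exp (-(l * (K * R) / 2)) ≤ e := by
      apply Real.exp_le_exp.2
      rw [hlu]
      linarith
    have hb3 : Real.exp (-L) * e ≤ 1 * e := by
      gcongr
      exact Real.exp_le_one_iff.2 (by linarith)
    linarith

end Changepoint

namespace Changepoint

/-! ### Second-moment lower bound for testing -/

section SecondMoment

/-- With `T` the averaged likelihood ratio, `φ + T (1 - φ) ≥ 1 - |T - 1|`, and `|T - 1| ≤ ((T - 1)²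
+ a²) / (2a)` pointwise. Integrating with `E (T - 1)² ≤ a²` gives the bound. -/
theorem one_sub_le_of_second_moment {Ω ι : Type*} [MeasurableSpace Ω] [Fintype ι] [Nonempty ι]
    {P : Measure Ω} [IsProbabilityMeasure P] {ℓ : ι → Ω → ℝ} (hℓ : ∀ i, Integrable (ℓ i) P)
    (hℓ1 : ∀ i, ∫ x, ℓ i x ∂P = 1) (hℓ2 : ∀ i j, Integrable (fun x => ℓ i x * ℓ j x) P) {a : ℝ}
    (ha : 0 < a)
    (hM : ∑ i, ∑ j, ∫ x, ℓ i x * ℓ j x ∂P ≤ (1 + a ^ 2) * (Fintype.card ι : ℝ) ^ 2)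
    {φ : Ω → ℝ} (hφ : Measurable φ) (hφ1 : ∀ x, φ x ∈ Set.Icc (0 : ℝ) 1) :
    1 - a ≤ ∫ x, φ x ∂P + (Fintype.card ι : ℝ)⁻¹ * ∑ i, ∫ x, ℓ i x * (1 - φ x) ∂P := by
  set N : ℝ := (Fintype.card ι : ℝ) with hN
  have hN0 : 0 < N := Nat.cast_pos.2 Fintype.card_pos
  have hφi : Integrable φ P := by
    refine Integrable.of_bound hφ.aestronglyMeasurable 1 (Filter.Eventually.of_forall fun x => ?_)
    rw [Real.norm_of_nonneg (hφ1 x).1]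
    exact (hφ1 x).2
  have hℓφ : ∀ i, Integrable (fun x => ℓ i x * (1 - φ x)) P := fun i => by
    refine (hℓ i).mul_bdd (c := 1) (measurable_const.sub hφ).aestronglyMeasurable
      (Filter.Eventually.of_forall fun x => ?_)
    rw [Real.norm_of_nonneg (by linarith [(hφ1 x).2])]
    linarith [(hφ1 x).1]
  have hsumφ : Integrable (fun x => ∑ i, ℓ i x * (1 - φ x)) P :=
    integrable_finsetSum _ fun i _ => hℓφ i
  have hsum : Integrable (fun x => ∑ i, ℓ i x) P := integrable_finsetSum _ fun i _ => hℓ i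
  have hsum2 : Integrable (fun x => ∑ i, ∑ j, ℓ i x * ℓ j x) P :=
    integrable_finsetSum _ fun i _ => integrable_finsetSum _ fun j _ => hℓ2 i j
  have hleft : ∫ x, φ x ∂P + N⁻¹ * ∑ i, ∫ x, ℓ i x * (1 - φ x) ∂P =
      ∫ x, (φ x + N⁻¹ * ∑ i, ℓ i x * (1 - φ x)) ∂P := by
    rw [integral_add hφi (hsumφ.const_mul _), integral_const_mul,
      integral_finsetSum _ fun i _ => hℓφ i]
  have haff : Integrable (fun x => (1 - a / 2 - (2 * a)⁻¹) + a⁻¹ * N⁻¹ * ∑ i, ℓ i x) P :=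
    (integrable_const _).add (hsum.const_mul _)
  have hright : ∫ x, ((1 - a / 2 - (2 * a)⁻¹) + a⁻¹ * N⁻¹ * ∑ i, ℓ i x -
      (2 * a)⁻¹ * (N ^ 2)⁻¹ * ∑ i, ∑ j, ℓ i x * ℓ j x) ∂P =
      (1 - a / 2 - (2 * a)⁻¹) + a⁻¹ * N⁻¹ * N -
        (2 * a)⁻¹ * (N ^ 2)⁻¹ * ∑ i, ∑ j, ∫ x, ℓ i x * ℓ j x ∂P := by
    rw [integral_sub haff (hsum2.const_mul _),
      integral_add (integrable_const _) (hsum.const_mul _), integral_const_mul, integral_const_mul,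
      integral_finsetSum _ fun i _ => hℓ i,
      integral_finsetSum _ fun i _ => integrable_finsetSum _ fun j _ => hℓ2 i j]
    simp_rw [integral_finsetSum _ fun j _ => hℓ2 _ j, hℓ1]
    simp [hN]
  have hval : 1 - a ≤ (1 - a / 2 - (2 * a)⁻¹) + a⁻¹ * N⁻¹ * N -
        (2 * a)⁻¹ * (N ^ 2)⁻¹ * ∑ i, ∑ j, ∫ x, ℓ i x * ℓ j x ∂P := by
    have h1 : (2 * a)⁻¹ * (N ^ 2)⁻¹ * ∑ i, ∑ j, ∫ x, ℓ i x * ℓ j x ∂P ≤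
        (2 * a)⁻¹ * (N ^ 2)⁻¹ * ((1 + a ^ 2) * N ^ 2) := by gcongr
    have h2 : (2 * a)⁻¹ * (N ^ 2)⁻¹ * ((1 + a ^ 2) * N ^ 2) = (2 * a)⁻¹ + a / 2 := by
      field_simp
    have h3 : a⁻¹ * N⁻¹ * N = (2 * a)⁻¹ + (2 * a)⁻¹ := by
      field_simp
      norm_num
    linarith
  rw [hleft]
  refine (hval.trans_eq hright.symm).trans (integral_mono
    (haff.sub (hsum2.const_mul _))
    (hφi.add (hsumφ.const_mul _)) fun x => ?_)
  simp only
  set T := N⁻¹ * ∑ i, ℓ i x with hT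
  have e1 : a⁻¹ * N⁻¹ * ∑ i, ℓ i x = a⁻¹ * T := by rw [hT, mul_assoc]
  have e2 : (2 * a)⁻¹ * (N ^ 2)⁻¹ * ∑ i, ∑ j, ℓ i x * ℓ j x = (2 * a)⁻¹ * T ^ 2 := by
    rw [← Finset.sum_mul_sum, hT, mul_pow, inv_pow]
    ring
  have e3 : N⁻¹ * ∑ i, ℓ i x * (1 - φ x) = T * (1 - φ x) := by
    rw [← Finset.sum_mul, hT, mul_assoc]
  rw [e1, e2, e3]
  have h4 : (1 - a / 2 - (2 * a)⁻¹) + a⁻¹ * T - (2 * a)⁻¹ * T ^ 2 =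
      1 - ((T - 1) ^ 2 + a ^ 2) / (2 * a) := by
    field_simp
    ring
  have h5 : |T - 1| ≤ ((T - 1) ^ 2 + a ^ 2) / (2 * a) := by
    rw [le_div_iff₀ (by positivity), ← sq_abs (T - 1)]
    nlinarith [sq_nonneg (|T - 1| - a)]
  have h6 : -|T - 1| ≤ (1 - φ x) * (T - 1) := by
    have h7 := neg_abs_le (T - 1)
    have h8 := abs_nonneg (T - 1)
    have h9 := (hφ1 x).1
    have h10 := (hφ1 x).2
    nlinarith
  rw [h4]
  linarith

end SecondMoment

variable {p n : ℕ} {S : Matrix (Fin p) (Fin p) ℝ}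

section Reduction

theorem integral_le_iSup {A : Set (Obs p n)} {ψ : Obs p n → ℝ} (hψ : ψ ∈ Tests p n) {θ : Obs p n}
    (hθ : θ ∈ A) : ∫ x, ψ x ∂(dataLaw S θ) ≤ ⨆ θ : A, ∫ x, ψ x ∂(dataLaw S θ.1) :=
  le_ciSup (f := fun θ : A => ∫ x, ψ x ∂(dataLaw S θ.1))
    ⟨1, by rintro _ ⟨φ, rfl⟩; exact (integral_test_mem_Icc hψ φ.1).2⟩ ⟨θ, hθ⟩

/-- Each supremum dominates what the prior sees: the null one its value at `θ = 0`, the alternative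
one the average over `η`. -/
theorem one_sub_le_minimaxError (hS : S.PosDef) {ι : Type*} [Fintype ι] [Nonempty ι] {s : ℕ}
    {ρ a : ℝ} (ha : 0 < a) {η : ι → Fin n → Fin p → ℝ}
    (hη : ∀ i, colored hS (η i) ∈ changeSpace p n s ρ)
    (hM : ∑ i, ∑ j, Real.exp (∑ t, ∑ k, η i t k * η j t k) ≤
      (1 + a ^ 2) * (Fintype.card ι : ℝ) ^ 2) :
    1 - a ≤ minimaxError p n S s ρ := by
  have : Nonempty (Tests p n) := ⟨⟨0, measurable_const, fun x => by simp⟩⟩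
  refine le_ciInf fun ψ => ?_
  obtain ⟨ψ, hψ⟩ := ψ
  have h := one_sub_le_of_second_moment (P := stdArray p n) (ℓ := fun i => likelihood (η i))
    (fun i => integrable_likelihood _) (fun i => integral_likelihood _)
    (fun i j => integrable_likelihood_mul _ _) ha
    (by simp_rw [integral_likelihood_mul]; exact hM)
    (hψ.1.comp (measurable_colored (n := n) hS)) fun x => hψ.2 _
  refine h.trans (add_le_add ?_ ?_)
  · have h0 : colored (n := n) hS 0 ∈ nullSpace p n := ⟨0, fun t => by simp [colored]⟩
    refine le_trans (le_of_eq ?_) (integral_le_iSup hψ h0)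
    rw [integral_dataLaw_colored hS 0 hψ.1]
    simp [likelihood]
  · have hN0 : (0 : ℝ) < Fintype.card ι := by exact_mod_cast Fintype.card_pos
    rw [inv_mul_le_iff₀ hN0, ← nsmul_eq_mul, ← Finset.card_univ]
    refine Finset.sum_le_card_nsmul _ _ _ fun i _ => ?_
    refine le_trans (le_of_eq ?_) (integral_le_iSup (one_sub_mem_Tests hψ) (hη i))
    rw [integral_dataLaw_colored hS (η i) (one_sub_mem_Tests hψ).1]
    rfl

end Reduction

/-! ### Random signs and dyadic correlations -/

section Signs

/-- The real sign attached to a Boolean. -/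
def boolSign (b : Bool) : ℝ := if b then 1 else -1

theorem boolSign_sq (b : Bool) : boolSign b ^ 2 = 1 := by cases b <;> simp [boolSign]

theorem sum_exp_mul_boolSign (x : ℝ) (b : Bool) :
    ∑ b', Real.exp (x * (boolSign b * boolSign b')) = 2 * Real.cosh x := by
  rw [Real.cosh_eq]
  cases b <;> simp [boolSign] <;> ring

theorem sum_exp_signs (x : Fin p → ℝ) :
    ∑ ξ : Fin p → Bool, ∑ ξ' : Fin p → Bool,
      Real.exp (∑ j, x j * (boolSign (ξ j) * boolSign (ξ' j))) =
      ((2 : ℝ) ^ p) ^ 2 * ∏ j, Real.cosh (x j) := by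
  have h : ∀ ξ : Fin p → Bool, ∑ ξ' : Fin p → Bool,
      Real.exp (∑ j, x j * (boolSign (ξ j) * boolSign (ξ' j))) =
      2 ^ p * ∏ j, Real.cosh (x j) := by
    intro ξ
    simp_rw [Real.exp_sum]
    rw [← Fintype.prod_sum (fun j b => Real.exp (x j * (boolSign (ξ j) * boolSign b)))]
    simp_rw [sum_exp_mul_boolSign]
    rw [Finset.prod_mul_distrib]
    simp
  simp_rw [h]
  simp
  ring

end Signs

section Dyadic

theorem sqrt_half_sq : √(1 / 2 : ℝ) ^ 2 = 1 / 2 := Real.sq_sqrt (by norm_num)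

theorem sqrt_half_pos : 0 < √(1 / 2 : ℝ) := Real.sqrt_pos.2 (by norm_num)

theorem sqrt_half_lt : √(1 / 2 : ℝ) < 3 / 4 := by
  rw [Real.sqrt_lt' (by norm_num)]
  norm_num

theorem sum_range_sqrt_half_pow_le (N : ℕ) : ∑ k ∈ Finset.range N, √(1 / 2 : ℝ) ^ k ≤ 4 := by
  have h := geom_sum_mul_neg √(1 / 2 : ℝ) N
  have h1 : 0 < √(1 / 2 : ℝ) ^ N := pow_pos sqrt_half_pos N
  have h2 : 0 ≤ ∑ k ∈ Finset.range N, √(1 / 2 : ℝ) ^ k :=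
    Finset.sum_nonneg fun k _ => (pow_pos sqrt_half_pos k).le
  nlinarith [sqrt_half_lt]

/-- The correlation between the dyadic locations `2 ^ i` and `2 ^ j`. -/
noncomputable def dyadicCorr (i j : ℕ) : ℝ := 2 ^ min i j * (√(1 / 2) ^ i * √(1 / 2) ^ j)

theorem dyadicCorr_comm (i j : ℕ) : dyadicCorr i j = dyadicCorr j i := by
  rw [dyadicCorr, dyadicCorr, min_comm, mul_comm (_ ^ i)]

theorem dyadicCorr_add (i k : ℕ) : dyadicCorr i (i + k) = √(1 / 2) ^ k := by
  rw [dyadicCorr, min_eq_left (Nat.le_add_right i k), pow_add]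
  calc (2 : ℝ) ^ i * (√(1 / 2) ^ i * (√(1 / 2) ^ i * √(1 / 2) ^ k))
      = (2 * √(1 / 2) ^ 2) ^ i * √(1 / 2) ^ k := by rw [mul_pow, ← pow_mul]; ring
    _ = √(1 / 2) ^ k := by rw [sqrt_half_sq]; norm_num

theorem dyadicCorr_nonneg (i j : ℕ) : 0 ≤ dyadicCorr i j := by
  unfold dyadicCorr
  positivity

theorem dyadicCorr_le_one (i j : ℕ) : dyadicCorr i j ≤ 1 := by
  wlog h : i ≤ j generalizing i j
  · rw [dyadicCorr_comm]
    exact this j i (by omega)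
  obtain ⟨k, rfl⟩ := Nat.exists_eq_add_of_le h
  rw [dyadicCorr_add]
  exact pow_le_one₀ sqrt_half_pos.le (by linarith [sqrt_half_lt])

/-- `dyadicCorr i j` equals `2 ^ (-|i - j| / 2)`, so each side of the diagonal is a geometric series
of sum at most `4`. -/
theorem sum_dyadicCorr_le (m : ℕ) {i : ℕ} (hi : i < m) :
    ∑ j ∈ Finset.range m, dyadicCorr i j ≤ 8 := by
  rw [← Finset.sum_range_add_sum_Ico _ hi.le]
  have h1 : ∑ j ∈ Finset.range i, dyadicCorr i j ≤ 4 := by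
    refine le_trans ?_ (sum_range_sqrt_half_pow_le (i + 1))
    have h : ∀ j ∈ Finset.range (i + 1), dyadicCorr i j = √(1 / 2) ^ (i + 1 - 1 - j) := by
      intro j hj
      obtain ⟨k, rfl⟩ := Nat.exists_eq_add_of_le (Nat.lt_succ_iff.1 (Finset.mem_range.1 hj))
      rw [dyadicCorr_comm, dyadicCorr_add]
      congr 1
      omega
    rw [← Finset.sum_range_reflect (fun k => √(1 / 2 : ℝ) ^ k), ← Finset.sum_congr rfl h,
      Finset.sum_range_succ]
    linarith [dyadicCorr_nonneg i i]
  have h2 : ∑ j ∈ Finset.Ico i m, dyadicCorr i j ≤ 4 := by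
    rw [Finset.sum_Ico_eq_sum_range]
    simp_rw [dyadicCorr_add]
    exact sum_range_sqrt_half_pow_le _
  linarith

end Dyadic

/-! ### The least favourable prior -/

section Prior

/-- Standardized coordinates of the signal with a change at `2 ^ i` in the direction with squared
standardized coordinates `b` and signs `ξ`. -/
noncomputable def priorSignal (n : ℕ) (b : Fin p → ℝ) (i : ℕ) (ξ : Fin p → Bool) (t : Fin n)
    (j : Fin p) : ℝ :=
  if (t : ℕ) < 2 ^ i then √2 * √(1 / 2) ^ i * (√(b j) * boolSign (ξ j)) else 0

theorem sum_priorSignal_mul {b : Fin p → ℝ} (hb : ∀ j, 0 ≤ b j) {i i' : ℕ} (hi : 2 ^ i ≤ n)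
    (hi' : 2 ^ i' ≤ n) (ξ ξ' : Fin p → Bool) :
    ∑ t, ∑ j, priorSignal n b i ξ t j * priorSignal n b i' ξ' t j =
      ∑ j, (2 * dyadicCorr i i' * b j) * (boolSign (ξ j) * boolSign (ξ' j)) := by
  have h : ∀ (t : Fin n) (j : Fin p), priorSignal n b i ξ t j * priorSignal n b i' ξ' t j =
      (if (t : ℕ) < 2 ^ min i i' then (1 : ℝ) else 0) *
        (2 * (√(1 / 2) ^ i * √(1 / 2) ^ i') * b j * (boolSign (ξ j) * boolSign (ξ' j))) := by
    intro t j
    have hmin : 2 ^ min i i' = min (2 ^ i) (2 ^ i') :=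
      (Monotone.map_min (pow_right_mono₀ one_le_two) : _)
    have h2 : √2 * √2 = (2 : ℝ) := Real.mul_self_sqrt (by norm_num)
    have h3 : √(b j) * √(b j) = b j := Real.mul_self_sqrt (hb j)
    simp only [priorSignal, hmin, lt_min_iff]
    by_cases h4 : (t : ℕ) < 2 ^ i
    · by_cases h5 : (t : ℕ) < 2 ^ i'
      · simp only [h4, h5, and_self, if_true]
        linear_combination (√(1 / 2) ^ i * √(1 / 2) ^ i' * (√(b j) * √(b j)) *
          boolSign (ξ j) * boolSign (ξ' j)) * h2 + 2 * (√(1 / 2) ^ i * √(1 / 2) ^ i' *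
          boolSign (ξ j) * boolSign (ξ' j)) * h3
      · simp [h5]
    · simp [h4]
  have hle : 2 ^ min i i' ≤ n := by
    rcases min_choice i i' with h | h <;> rw [h] <;> assumption
  simp_rw [h]
  rw [Finset.sum_comm]
  refine Finset.sum_congr rfl fun j _ => ?_
  rw [← Finset.sum_mul, sum_ite_lt hle, dyadicCorr]
  push_cast
  ring

theorem colored_priorSignal_mem (hS : S.PosDef) {b : Fin p → ℝ} (hb : ∀ j, 0 ≤ b j) {i : ℕ}
    (hi : i < Nat.log 2 n) (ξ : Fin p → Bool) {ρ : ℝ}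
    (hρ : ρ ^ 2 ≤ ∑ j, hS.1.eigenvalues j * b j) :
    colored hS (priorSignal n b i ξ) ∈ changeSpace p n p ρ := by
  have hin := two_mul_pow_le hi
  have hpos : 0 < 2 ^ i := by positivity
  simp only [changeSpace, Set.mem_iUnion, Finset.mem_Ico]
  set μ : EuclideanSpace ℝ (Fin p) := ∑ j, (√(hS.1.eigenvalues j) *
    (√2 * √(1 / 2) ^ i * (√(b j) * boolSign (ξ j)))) • hS.1.eigenvectorBasis j with hμ
  refine ⟨2 ^ i, ⟨by omega, by omega⟩, μ, 0, fun t ht => ?_, fun t ht => ?_, ?_, ?_⟩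
  · simp [colored, priorSignal, ht, hμ]
  · simp [colored, priorSignal, not_lt.2 ht]
  · exact hammingNorm_le_card_fintype.trans_eq (Fintype.card_fin p)
  · have hnorm : ‖μ‖ ^ 2 = 2 * (1 / 2) ^ i * ∑ j, hS.1.eigenvalues j * b j := by
      rw [hμ, norm_sq_sum_smul_orthonormalBasis, Finset.mul_sum]
      refine Finset.sum_congr rfl fun j _ => ?_
      simp only [mul_pow]
      rw [Real.sq_sqrt (hS.eigenvalues_pos j).le, Real.sq_sqrt (hb j), boolSign_sq,
        Real.sq_sqrt (by norm_num), ← pow_mul, mul_comm i 2, pow_mul, sqrt_half_sq]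
      ring
    have hsum : 0 ≤ ∑ j, hS.1.eigenvalues j * b j :=
      Finset.sum_nonneg fun j _ => mul_nonneg (hS.eigenvalues_pos j).le (hb j)
    have hn : (0 : ℝ) < n := by exact_mod_cast (by omega : 0 < n)
    have hin' : 2 * (2 : ℝ) ^ i ≤ n := by exact_mod_cast hin
    have h2i : (0 : ℝ) < 2 ^ i := by positivity
    rw [sub_zero, hnorm]
    refine hρ.trans ?_
    -- The `√2` in `priorSignal` compensates `(n - 2 ^ i) / n ≥ 1 / 2`, which holds because `2 * 2 ^
    -- i ≤ n`.
    have hcoef : 1 ≤ ((2 ^ i : ℕ) : ℝ) * ((n : ℝ) - ((2 ^ i : ℕ) : ℝ)) / n * (2 * (1 / 2) ^ i) := by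
      have : ((2 ^ i : ℕ) : ℝ) * ((n : ℝ) - ((2 ^ i : ℕ) : ℝ)) / n * (2 * (1 / 2) ^ i) =
          2 * (n - 2 ^ i) / n := by
        push_cast
        rw [one_div, inv_pow]
        field_simp
      rw [this, le_div_iff₀ hn]
      linarith
    rw [← mul_assoc]
    exact le_mul_of_one_le_left hsum hcoef

theorem log_le_four_mul_natLog (hn : 2 ≤ n) : Real.log (8 * (n : ℝ)) ≤ 4 * Nat.log 2 n := by
  set m := Nat.log 2 n with hm
  have h1 : (2 : ℝ) ≤ n := by exact_mod_cast hn
  have hm1 : 1 ≤ m := Nat.le_log_of_pow_le one_lt_two (by simpa using hn)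
  have h2 : (n : ℝ) ≤ 2 ^ (m + 1) := by
    exact_mod_cast (Nat.lt_pow_succ_log_self one_lt_two n).le
  have h3 : Real.log (8 * n) ≤ Real.log (2 ^ (m + 4)) := by
    apply Real.log_le_log (by linarith)
    calc 8 * (n : ℝ) ≤ 8 * 2 ^ (m + 1) := by gcongr
      _ = 2 ^ (m + 4) := by ring
  rw [Real.log_pow] at h3
  push_cast at h3
  have h4 := Real.log_two_lt_d9
  have h5 : (1 : ℝ) ≤ m := by exact_mod_cast hm1
  nlinarith

theorem exp_mul_le_one_add {q x : ℝ} (hq0 : 0 ≤ q) (hq1 : q ≤ 1) :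
    Real.exp (q * x) ≤ 1 + q * Real.exp x := by
  have h := convexOn_exp.2 (Set.mem_univ (0 : ℝ)) (Set.mem_univ x) (sub_nonneg.2 hq1) hq0 (by ring)
  simp only [smul_eq_mul, mul_zero, zero_add, Real.exp_zero, mul_one] at h
  linarith

theorem minimaxError_ge_of_prior (hn : 2 ≤ n) (hS : S.PosDef) {b : Fin p → ℝ}
    (hb : ∀ j, 0 ≤ b j) {ρ c : ℝ} (hc : 0 < c) (hc1 : c ^ 2 ≤ 1 / 2)
    (hρ : ρ ^ 2 ≤ ∑ j, hS.1.eigenvalues j * b j)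
    (hcosh : ∀ k, 0 ≤ k → k ≤ 2 → ∏ j, Real.cosh (k * b j) ≤
      Real.exp (k * (c ^ 2 * Real.log (Real.log (8 * (n : ℝ)))))) :
    1 - 8 * c ≤ minimaxError p n S p ρ := by
  set m := Nat.log 2 n with hm
  set L := Real.log (Real.log (8 * (n : ℝ))) with hL
  have hm1 : 1 ≤ m := Nat.le_log_of_pow_le one_lt_two (by simpa using hn)
  have : Nonempty (Fin m) := ⟨⟨0, hm1⟩⟩
  have hle : ∀ i : Fin m, 2 ^ (i : ℕ) ≤ n := fun i => by
    have := two_mul_pow_le i.2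
    omega
  refine one_sub_le_minimaxError hS (ι := Fin m × (Fin p → Bool)) (by positivity)
    (η := fun q => priorSignal n b q.1 q.2)
    (fun q => colored_priorSignal_mem hS hb q.1.2 q.2 hρ) ?_
  simp_rw [sum_priorSignal_mul hb (hle _) (hle _)]
  have hbound : ∀ i i' : ℕ, ∏ j, Real.cosh (2 * dyadicCorr i i' * b j) ≤
      1 + dyadicCorr i i' * (2 * c ^ 2 * Real.exp L) := by
    intro i i'
    have h0 := dyadicCorr_nonneg i i'
    have h1 := dyadicCorr_le_one i i'
    refine (hcosh _ (by linarith) (by linarith)).trans ?_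
    -- Convexity makes the bound linear in the correlation, so only row sums matter afterwards; `c ^
    -- 2 ≤ 1 / 2` ensures `q ≤ 1`.
    have h2 := exp_mul_le_one_add (q := dyadicCorr i i' * (2 * c ^ 2)) (x := L) (by positivity)
      (by nlinarith)
    refine le_trans (le_of_eq ?_) (h2.trans (le_of_eq ?_))
    · congr 1
      ring
    · ring
  have hrow : ∀ i : Fin m, ∑ i' : Fin m, dyadicCorr i i' ≤ 8 := fun i => by
    rw [Fin.sum_univ_eq_sum_range (fun j => dyadicCorr i j)]
    exact sum_dyadicCorr_le m i.2
  have hexp : Real.exp L ≤ 4 * m := (exp_loglog hn).trans_le (log_le_four_mul_natLog hn)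
  calc ∑ q : Fin m × (Fin p → Bool), ∑ q' : Fin m × (Fin p → Bool),
        Real.exp (∑ j, 2 * dyadicCorr q.1 q'.1 * b j * (boolSign (q.2 j) * boolSign (q'.2 j)))
      = ∑ i : Fin m, ∑ i' : Fin m, ((2 : ℝ) ^ p) ^ 2 *
          ∏ j, Real.cosh (2 * dyadicCorr i i' * b j) := by
        simp_rw [← sum_exp_signs, Fintype.sum_prod_type]
        exact Finset.sum_congr rfl fun i _ => Finset.sum_comm
    _ ≤ ∑ i : Fin m, ∑ i' : Fin m, ((2 : ℝ) ^ p) ^ 2 *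
          (1 + dyadicCorr i i' * (2 * c ^ 2 * Real.exp L)) := by
        gcongr
        exact hbound _ _
    _ = ((2 : ℝ) ^ p) ^ 2 * ∑ i : Fin m,
          (m + (∑ i' : Fin m, dyadicCorr i i') * (2 * c ^ 2 * Real.exp L)) := by
        simp_rw [← Finset.mul_sum, Finset.sum_add_distrib, Finset.sum_mul]
        simp
    _ ≤ ((2 : ℝ) ^ p) ^ 2 * ∑ i : Fin m, (m + 8 * (2 * c ^ 2 * (4 * m))) := by
        gcongr
        exact hrow _
    _ = (1 + (8 * c) ^ 2) * (Fintype.card (Fin m × (Fin p → Bool)) : ℝ) ^ 2 := by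
        simp
        ring

theorem exists_prior_profile (hp : 1 ≤ p) (hn : 2 ≤ n) (hS : S.PosDef) {c : ℝ}
    (hc1 : c ^ 2 ≤ 1 / 2) :
    ∃ b : Fin p → ℝ, (∀ j, 0 ≤ b j) ∧ c ^ 2 * rateSq p n S = ∑ j, hS.1.eigenvalues j * b j ∧
      ∀ k, 0 ≤ k → k ≤ 2 → ∏ j, Real.cosh (k * b j) ≤
        Real.exp (k * (c ^ 2 * Real.log (Real.log (8 * (n : ℝ))))) := by
  unfold rateSq
  set L := Real.log (Real.log (8 * (n : ℝ))) with hL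
  have hL1 : 1 ≤ L := one_le_loglog hn
  obtain ⟨j₀, hj₀⟩ := exists_eigenvalues_eq_opNorm hp hS
  rcases le_total (opNorm S * L) (frobNorm S * √L) with h | h
  · rw [max_eq_left h]
    have hF2 := frobNorm_sq_eq hS.1
    have hF : 0 < frobNorm S := by
      have : 0 < opNorm S * L := mul_pos (opNorm_pos hp hS) (by linarith)
      exact pos_of_mul_pos_left (this.trans_le h) (Real.sqrt_nonneg _)
    -- Since `cosh x ≤ exp (x² / 2)`, the constraint is on `∑ b j ^ 2`; by Cauchy–Schwarz the signal
    -- `∑ λ j * b j` is then largest for `b` proportional to the eigenvalues.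
    refine ⟨fun j => c ^ 2 * √L / frobNorm S * hS.1.eigenvalues j, fun j =>
      mul_nonneg (by positivity) (hS.eigenvalues_pos j).le, ?_, fun k hk0 hk2 => ?_⟩
    · have : ∀ j, hS.1.eigenvalues j * (c ^ 2 * √L / frobNorm S * hS.1.eigenvalues j) =
          c ^ 2 * √L / frobNorm S * hS.1.eigenvalues j ^ 2 := fun j => by ring
      simp_rw [this]
      rw [← Finset.mul_sum, ← hF2]
      field_simp
    · refine (Finset.prod_le_prod (fun j _ => (Real.cosh_pos _).le)
        fun j _ => Real.cosh_le_exp_half_sq _).trans ?_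
      rw [← Real.exp_sum]
      apply Real.exp_le_exp.2
      have : ∀ j, (k * (c ^ 2 * √L / frobNorm S * hS.1.eigenvalues j)) ^ 2 / 2 =
          (k * (c ^ 2 * √L / frobNorm S)) ^ 2 / 2 * hS.1.eigenvalues j ^ 2 := fun j => by ring
      simp_rw [this]
      rw [← Finset.mul_sum, ← hF2]
      have h2 : (k * (c ^ 2 * √L / frobNorm S)) ^ 2 / 2 * frobNorm S ^ 2 =
          (k * (c ^ 2 * L)) * (k * c ^ 2 / 2) := by
        have h3 : √L ^ 2 = L := Real.sq_sqrt (by linarith)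
        field_simp
        rw [h3]
      rw [h2]
      refine mul_le_of_le_one_right (by positivity) ?_
      nlinarith [sq_nonneg c]
  · rw [max_eq_right h]
    -- When the operator norm dominates, all signal goes in a top eigenvector, and `cosh x ≤ exp x`
    -- suffices.
    refine ⟨Pi.single j₀ (c ^ 2 * L), fun j => ?_, ?_, fun k hk0 hk2 => ?_⟩
    · by_cases hj : j = j₀
      · subst hj
        simp only [Pi.single_eq_same]
        positivity
      · simp [hj]
    · rw [Finset.sum_eq_single j₀ (fun j _ hj => by simp [hj]) (by simp)]
      simp only [Pi.single_eq_same, hj₀]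
      ring
    · rw [Finset.prod_eq_single j₀ (fun j _ hj => by simp [hj]) (by simp)]
      simp only [Pi.single_eq_same]
      have hx : 0 ≤ k * (c ^ 2 * L) := by positivity
      rw [Real.cosh_eq]
      have : Real.exp (-(k * (c ^ 2 * L))) ≤ Real.exp (k * (c ^ 2 * L)) :=
        Real.exp_le_exp.2 (by linarith)
      linarith

theorem one_sub_le_minimaxError_rate (hp : 1 ≤ p) (hn : 2 ≤ n) (hS : S.PosDef) {c : ℝ}
    (hc : 0 < c) (hc1 : c ^ 2 ≤ 1 / 2) :
    1 - 8 * c ≤ minimaxError p n S p (c * √(rateSq p n S)) := by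
  obtain ⟨b, hb, hsum, hcosh⟩ := exists_prior_profile hp hn hS hc1
  refine minimaxError_ge_of_prior hn hS hb hc hc1 ?_ hcosh
  rw [mul_pow, Real.sq_sqrt (rateSq_pos hp hn hS).le, hsum]

end Prior

/-! ### The rate and its uniqueness up to constants -/

theorem isDenseMinimaxRate_sqrt_rateSq :
    IsDenseMinimaxRate (fun p n S => √(rateSq p n S)) := by
  refine ⟨fun ε hε => ?_, fun ε hε => ⟨ε / 8, by linarith [hε.1], ?_⟩⟩
  -- Chosen so that `4 * exp (2 - K / 8) = ε`.
  · set K := 16 + 8 * Real.log (4 / ε) with hK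
    have hlog : 0 ≤ Real.log (4 / ε) :=
      Real.log_nonneg (by rw [le_div_iff₀ hε.1]; linarith [hε.2])
    have hK16 : 16 ≤ K := by linarith
    refine ⟨4 * √K, by positivity, fun p n S hp hn hS C hC => ?_⟩
    have hR := rateSq_pos hp hn hS
    refine (minimaxError_le_of_scan hp hn hS hK16 ?_).trans (le_of_eq ?_)
    · rw [mul_pow, Real.sq_sqrt hR.le, ← mul_assoc]
      refine mul_le_mul_of_nonneg_right ?_ hR.le
      have h := pow_le_pow_left₀ (by positivity) hC.le 2
      rw [mul_pow, Real.sq_sqrt (by linarith)] at h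
      linarith
    · have : 2 - K / 8 = -Real.log (4 / ε) := by rw [hK]; ring
      rw [this, Real.exp_neg, Real.exp_log (by have := hε.1; positivity)]
      field_simp
  · intro p n S hp hn hS c hc
    have h1 := hc.1
    have h2 := hc.2
    have h3 := hε.2
    refine le_trans ?_ (one_sub_le_minimaxError_rate hp hn hS hc.1 (by nlinarith))
    linarith

/-- If `r₁` were much smaller than `r₂`, the error at `ρ = 2 * C * r₁` would be both at most `1 / 4`
and at least `3 / 4`. -/
theorem exists_le_mul_of_rates {r₁ r₂ : (p n : ℕ) → Matrix (Fin p) (Fin p) ℝ → ℝ}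
    (h₁ : IsDenseMinimaxRate r₁) (h₂ : IsDenseMinimaxRate r₂)
    (hpos : ∀ (p n : ℕ) (S : Matrix (Fin p) (Fin p) ℝ), 1 ≤ p → 2 ≤ n → S.PosDef → 0 < r₁ p n S)
    (hpos₂ : ∀ (p n : ℕ) (S : Matrix (Fin p) (Fin p) ℝ), 1 ≤ p → 2 ≤ n → S.PosDef →
      0 < r₂ p n S) :
    ∃ a : ℝ, 0 < a ∧ ∀ (p n : ℕ) (S : Matrix (Fin p) (Fin p) ℝ), 1 ≤ p → 2 ≤ n → S.PosDef →
      a * r₂ p n S ≤ r₁ p n S := by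
  obtain ⟨C, hC, hupper⟩ := h₁.1 (1 / 4) (by norm_num)
  obtain ⟨c, hc, hlower⟩ := h₂.2 (1 / 4) (by norm_num)
  refine ⟨c / (2 * C), by positivity, fun p n S hp hn hS => ?_⟩
  by_contra! hlt
  have h1 := hpos p n S hp hn hS
  have h2 := hpos₂ p n S hp hn hS
  have hu := hupper p n S hp hn hS (2 * C) (by linarith)
  have hl := hlower p n S hp hn hS (2 * C * r₁ p n S / r₂ p n S) ⟨by positivity, by
    rw [div_lt_iff₀ h2]
    rw [div_mul_eq_mul_div, lt_div_iff₀ (by positivity)] at hlt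
    linarith⟩
  rw [div_mul_cancel₀ _ h2.ne'] at hl
  linarith

/-- The multiplier is quantified after `p`, `n`, `S`, so it may be rescaled by `r₂ / r₁`;
monotonicity of the error in `ρ` is not needed. -/
theorem IsDenseMinimaxRate.of_bounds {r₁ r₂ : (p n : ℕ) → Matrix (Fin p) (Fin p) ℝ → ℝ}
    (h₁ : IsDenseMinimaxRate r₁) {a A : ℝ} (ha : 0 < a) (hA : 0 < A)
    (hpos : ∀ (p n : ℕ) (S : Matrix (Fin p) (Fin p) ℝ), 1 ≤ p → 2 ≤ n → S.PosDef → 0 < r₁ p n S)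
    (hbd : ∀ (p n : ℕ) (S : Matrix (Fin p) (Fin p) ℝ), 1 ≤ p → 2 ≤ n → S.PosDef →
      a * r₁ p n S ≤ r₂ p n S ∧ r₂ p n S ≤ A * r₁ p n S) : IsDenseMinimaxRate r₂ := by
  refine ⟨fun ε hε => ?_, fun ε hε => ?_⟩
  · obtain ⟨C₀, hC₀, h⟩ := h₁.1 ε hε
    refine ⟨C₀ / a, by positivity, fun p n S hp hn hS C hC => ?_⟩
    have h1 := hpos p n S hp hn hS
    have hb := (hbd p n S hp hn hS).1
    rw [div_lt_iff₀ ha] at hC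
    have hC0 : 0 < C := pos_of_mul_pos_left (hC₀.trans hC) ha.le
    have := h p n S hp hn hS (C * r₂ p n S / r₁ p n S) (by
      rw [lt_div_iff₀ h1]
      nlinarith)
    rwa [div_mul_cancel₀ _ h1.ne'] at this
  · obtain ⟨c₀, hc₀, h⟩ := h₁.2 ε hε
    refine ⟨c₀ / A, by positivity, fun p n S hp hn hS c hc => ?_⟩
    have h1 := hpos p n S hp hn hS
    have hb := hbd p n S hp hn hS
    have h2 : 0 < r₂ p n S := lt_of_lt_of_le (by positivity) hb.1
    have hcA := hc.2
    rw [lt_div_iff₀ hA] at hcA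
    have hc0 := hc.1
    have := h p n S hp hn hS (c * r₂ p n S / r₁ p n S) ⟨by positivity, by
      rw [div_lt_iff₀ h1]
      nlinarith⟩
    rwa [div_mul_cancel₀ _ h1.ne'] at this

end Changepoint

theorem mainTheorem5 :
    Changepoint.IsDenseMinimaxRate (fun p n S => √(Changepoint.rateSq p n S)) ∧
    ∀ ρstar : (p n : ℕ) → Matrix (Fin p) (Fin p) ℝ → ℝ,
      (∀ (p n : ℕ) (S : Matrix (Fin p) (Fin p) ℝ), 1 ≤ p → 2 ≤ n → S.PosDef →
        0 < ρstar p n S) →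
      (Changepoint.IsDenseMinimaxRate ρstar ↔
        ∃ a A : ℝ, 0 < a ∧ 0 < A ∧
          ∀ (p n : ℕ) (S : Matrix (Fin p) (Fin p) ℝ), 1 ≤ p → 2 ≤ n → S.PosDef →
            a * Changepoint.rateSq p n S ≤ ρstar p n S ^ 2 ∧
            ρstar p n S ^ 2 ≤ A * Changepoint.rateSq p n S) := by
  have hrate := Changepoint.isDenseMinimaxRate_sqrt_rateSq
  have hpos₀ : ∀ (p n : ℕ) (S : Matrix (Fin p) (Fin p) ℝ), 1 ≤ p → 2 ≤ n → S.PosDef →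
      0 < √(Changepoint.rateSq p n S) := fun p n S hp hn hS =>
    Real.sqrt_pos.2 (Changepoint.rateSq_pos hp hn hS)
  refine ⟨hrate, fun ρstar hpos => ⟨fun h => ?_, ?_⟩⟩
  · obtain ⟨a, ha, h1⟩ := Changepoint.exists_le_mul_of_rates h hrate hpos hpos₀
    obtain ⟨b, hb, h2⟩ := Changepoint.exists_le_mul_of_rates hrate h hpos₀ hpos
    refine ⟨a ^ 2, (b ^ 2)⁻¹, by positivity, by positivity, fun p n S hp hn hS => ?_⟩
    have hR := (Changepoint.rateSq_pos hp hn hS).le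
    have hρ := (hpos p n S hp hn hS).le
    constructor
    · have := pow_le_pow_left₀ (by positivity) (h1 p n S hp hn hS) 2
      rwa [mul_pow, Real.sq_sqrt hR] at this
    · have := pow_le_pow_left₀ (by positivity) (h2 p n S hp hn hS) 2
      rw [mul_pow, Real.sq_sqrt hR] at this
      rwa [← div_eq_inv_mul, le_div_iff₀' (by positivity)]
  · rintro ⟨a, A, ha, hA, h⟩
    refine hrate.of_bounds (Real.sqrt_pos.2 ha) (Real.sqrt_pos.2 hA) hpos₀
      fun p n S hp hn hS => ⟨?_, ?_⟩
    · rw [← Real.sqrt_mul ha.le]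
      exact Real.sqrt_le_iff.2 ⟨(hpos p n S hp hn hS).le, (h p n S hp hn hS).1⟩
    · rw [← Real.sqrt_mul hA.le]
      exact Real.le_sqrt_of_sq_le (h p n S hp hn hS).2
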